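/- **Setting.** Let $S,A$ be finite sets, $P(s'|s,a)$ transition probabilities, $\pi(a|s)$ a fixed policy, $r(s,a,s')$ a reward function, $0\le\gamma<1$, and $\xi$ a probability distribution on $S$ with all $\xi(s)>0$. Let $\Phi\in\mathbb R^{S\times d}$ be a feature matrix with linearly independent columns, whose row $s$ is the feature vector $\phi(s)$. Put $\Xi=\mathrm{diag}(\xi)$, $P^\pi(s,s')=\sum_a\pi(a|s)P(s'|s,a)$, $R(s)=\sum_{a,s'}\pi(a|s)P(s'|s,a)r(s,a,s')$, $\Phi'=P^\pi\Phi$, $M=\Phi^T\Xi\Phi$, and $$K(\theta)=\Phi^T\Xi(R+\gamma\Phi'\theta-\Phi\theta).$$ A sample $(s,a,s')$ has probability $\xi(s)\pi(a|s)P(s'|s,a)$; write $\phi=\phi(s)$, $\phi'=\phi(s')$, $\delta(\theta)=r(s,a,s')+\gamma\phi'^T\theta-\phi^T\theta$. Let $$\mathrm{NEU}(\theta)=\mathbb E[\delta(\theta)\phi]^T\,\mathbb E[\delta(\theta)\phi],\qquad \mathrm{MSPBE}(\theta)=\|\Phi\theta-\Pi T\Phi\theta\|_\Xi^2,$$ with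 $TV=R+\gamma P^\pi V$ and $\Pi=\Phi M^{-1}\Phi^T\Xi$. Let $h:\mathbb R^d\to\mathbb R$ be convex and $X,Y\subset\mathbb R^d$ non-empty, convex and compact. The algorithm is GTD or GTD2. For GTD put $J=\frac12\mathrm{NEU}+h$, $F^*(y)=\frac12\|y\|^2$, $\mathcal F^*(y)=y$ and $L_{F^*}=1$; for GTD2 put $J=\frac12\mathrm{MSPBE}+h$, $F^*(y)=\frac12y^TMy$, $\mathcal F^*(y)=\phi\phi^Ty$ and $L_{F^*}=\|\Phi^T\Xi\Phi\|_2$. In both cases let $$L(\theta,y)=\langle K(\theta),y\rangle-F^*(y)+h(\theta).$$ Given i.i.d. samples $(s_t,a_t,s_t')_{t\ge0}$, a starting point $(\theta_0,y_0)$ and step sizes $\alpha_t$, the algorithm is $$y_{t+1}=\mathrm{proj}_Y\bigl(y_t+\alpha_t(\delta_t(\theta_t)\phi_t-\mathcal F^*_t(y_t))\bigr),\qquad \theta_{t+1}=\mathrm{prox}_{\alpha_th}\bigl(\theta_t+\alpha_t(\phi_t-\gamma\phi_t')(y_t^T\phi_t)\bigr),$$ where $\mathrm{prox}_{\alpha h}(u)=\arg\min_{p\in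 X}\{\alpha h(p)+\frac12\|p-u\|^2\}$, and its output is $\bar\theta_N=\frac1N\sum_{i=1}^N\theta_i$, $\bar y_N=\frac1N\sum_{i=1}^Ny_i$. **Proposition 1.** For GTD and for GTD2: 1. (Primal–dual form.) $J(\theta)=\max_{y\in\mathbb R^d}L(\theta,y)$ for every $\theta\in\mathbb R^d$. 2. (True stochastic gradients.) For all $\theta,y\in\mathbb R^d$: $\mathbb E[\mathcal F^*(y)]=\nabla F^*(y)$, $\mathbb E[\delta(\theta)\phi]=K(\theta)$, $\mathbb E[-(\phi-\gamma\phi')(y^T\phi)]=\nabla_\theta\langle K(\theta),y\rangle$, and hence $\mathbb E[\delta(\theta)\phi-\mathcal F^*(y)]=\nabla_yL(\theta,y)$. Along the algorithm, given the samples before time $t$, the conditional expectation of $\delta_t(\theta_t)\phi_t-\mathcal F_t^*(y_t)$ is $\nabla_yL(\theta_t,y_t)$, and that of $-(\phi_t-\gamma\phi'_t)(y_t^T\phi_t)$ is $\nabla_\theta\langle K(\theta_t),y_t\rangle$. 3. (Rate.) Suppose that for all $\theta\in X$, $y\in Y$ the variances satisfy $\mathbb E\|\mathcal F^*(y)-\nabla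 F^*(y)\|^2\le\sigma_{F^*}^2$, $\mathbb E\|\delta(\theta)\phi-K(\theta)\|^2\le\sigma_{K,\theta}^2$ and $\mathbb E\|{-(\phi-\gamma\phi')(y^T\phi)}-\nabla_\theta\langle K(\theta),y\rangle\|^2\le\sigma_{K,y}^2$ with non-negative constants, and put $\sigma=\sqrt{\sigma_{F^*}^2+\sigma_{K,\theta}^2}+\sigma_{K,y}$. Let $L_K=\|\Phi^T\Xi(\Phi-\gamma\Phi')\|_2^2$ and let $\xi$ be stationary for $P^\pi$ (alternatively, $L_K=\|\Phi^T\Xi(\Phi-\gamma\Phi')\|_2$ and $\xi$ need not be stationary), and put $\Lambda=L_{F^*}+L_K+\sigma$. Let $X,Y$ have diameter at most $D$, let $(\theta_0,y_0)\in X\times Y$, $N\ge1$, and let the step sizes be non-increasing with $\frac{c_1}{\Lambda\sqrt N}\le\alpha_t\le\frac{c_2}{\Lambda\sqrt{t+1}}$ for $0\le t<N$, where $c_1>0$ (for instance $\alpha_t=\frac{c}{\Lambda\sqrt N}$ or $\alpha_t=\frac{c}{\Lambda\sqrt{t+1}}$). Then $$\mathbb E\Bigl[\max_{y\in Y}L(\bar\theta_N,y)-\min_{\theta\in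 X}L(\theta,\bar y_N)\Bigr]\le C\,\frac{L_{F^*}+L_K+\sigma}{\sqrt N},$$ where $C$ depends only on $D,c_1,c_2$. If moreover for every $\theta\in X$ the function $L(\theta,\cdot)$ attains its maximum over $\mathbb R^d$ at a point of $Y$, then also $$\mathbb E[J(\bar\theta_N)]-\min_{\theta\in X}J(\theta)\le C\,\frac{L_{F^*}+L_K+\sigma}{\sqrt N}.$$ -/

import Mathlib

open MeasureTheory ProbabilityTheory
open scoped Matrix RealInnerProductSpace

noncomputable section

/-- The space of weight vectors, with the Euclidean norm. -/
abbrev Vec (d : ℕ) : Type := EuclideanSpace ℝ (Fin d)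

/-- The two algorithms: gradient TD (objective NEU) and gradient TD 2 (objective MSPBE). -/
inductive GradTD where
  | gtd
  | gtd2

/-- Policy evaluation with linear features: a finite MDP with a fixed policy, a reward function,
a discount factor, a positive distribution `ξ` over the states, and a feature matrix `Φ` (its
row `s` is the feature vector of the state `s`) with linearly independent columns; further a
convex regularizer `h`, and convex compact sets `X` and `Y` for the primal and the dual
variable. -/
structure TDProblem (S A : Type*) [Fintype S] [Fintype A] (d : ℕ) where
  /-- transition probabilities: `P s a s'` is the probability of `s'` given `s` and `a` -/
  P : S → A → S → ℝ
  P_nonneg : ∀ s a s', 0 ≤ P s a s'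
  P_sum : ∀ s a, ∑ s', P s a s' = 1
  /-- the fixed policy -/
  policy : S → A → ℝ
  policy_nonneg : ∀ s a, 0 ≤ policy s a
  policy_sum : ∀ s, ∑ a, policy s a = 1
  reward : S → A → S → ℝ
  γ : ℝ
  γ_nonneg : 0 ≤ γ
  γ_lt_one : γ < 1
  ξ : S → ℝ
  ξ_pos : ∀ s, 0 < ξ s
  ξ_sum : ∑ s, ξ s = 1
  Φ : Matrix S (Fin d) ℝ
  Φ_rank : LinearIndependent ℝ Φ.col
  h : Vec d → ℝ
  h_convex : ConvexOn ℝ Set.univ h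
  X : Set (Vec d)
  X_convex : Convex ℝ X
  X_compact : IsCompact X
  X_nonempty : X.Nonempty
  Y : Set (Vec d)
  Y_convex : Convex ℝ Y
  Y_compact : IsCompact Y
  Y_nonempty : Y.Nonempty

/-- `prox X f u` is the minimizer over `X` of `f p + ‖p - u‖² / 2`. For `f = 0` it is the
Euclidean projection of `u` onto `X`. -/
def prox {d : ℕ} (X : Set (Vec d)) (f : Vec d → ℝ) (u : Vec d) : Vec d :=
  Classical.epsilon fun p => p ∈ X ∧ IsMinOn (fun q => f q + (1 / 2) * ‖q - u‖ ^ 2) X p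

namespace TDProblem

variable {S A : Type*} [Fintype S] [Fintype A] {d : ℕ}

/-- State transition matrix of the Markov reward process induced by the policy. -/
def transMat (Q : TDProblem S A d) : Matrix S S ℝ :=
  Matrix.of fun s s' => ∑ a, Q.policy s a * Q.P s a s'

/-- Expected one-step reward vector `R` of the induced Markov reward process. -/
def rewardVec (Q : TDProblem S A d) : S → ℝ :=
  fun s => ∑ a, ∑ s', Q.policy s a * Q.P s a s' * Q.reward s a s'

/-- `ξ` is a stationary distribution of the induced Markov reward process. -/
def IsStationary (Q : TDProblem S A d) : Prop := Q.ξ ᵥ* Q.transMat = Q.ξ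

/-- Expected next features: row `s` of `Φ'` is the mean of the features of the successor of `s`. -/
def PhiNext (Q : TDProblem S A d) : Matrix S (Fin d) ℝ := Q.transMat * Q.Φ

/-- The diagonal matrix `Ξ`. -/
def Xi [DecidableEq S] (Q : TDProblem S A d) : Matrix S S ℝ := Matrix.diagonal Q.ξ

/-- The matrix `M = Φᵀ Ξ Φ`. -/
def gram [DecidableEq S] (Q : TDProblem S A d) : Matrix (Fin d) (Fin d) ℝ :=
  Q.Φᵀ * Q.Xi * Q.Φ

/-- The matrix `Φᵀ Ξ (Φ - γ Φ')`. -/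
def tdMat [DecidableEq S] (Q : TDProblem S A d) : Matrix (Fin d) (Fin d) ℝ :=
  Q.Φᵀ * Q.Xi * (Q.Φ - Q.γ • Q.PhiNext)

/-- `K(θ) = Φᵀ Ξ (R + γ Φ' θ - Φ θ)`. -/
def K [DecidableEq S] (Q : TDProblem S A d) (θ : Vec d) : Vec d :=
  WithLp.toLp 2 ((Q.Φᵀ * Q.Xi) *ᵥ
    (Q.rewardVec + Q.γ • (Q.PhiNext *ᵥ θ.ofLp) - Q.Φ *ᵥ θ.ofLp))

/-! ### Samples -/

/-- Feature vector of a state. -/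
def feat (Q : TDProblem S A d) (s : S) : Vec d := WithLp.toLp 2 (Q.Φ s)

/-- Probability of the sample `z = (s, a, s')`. -/
def weight (Q : TDProblem S A d) (z : S × A × S) : ℝ :=
  Q.ξ z.1 * Q.policy z.1 z.2.1 * Q.P z.1 z.2.1 z.2.2

/-- Expectation with respect to one sample. -/
def expect {E : Type*} [AddCommGroup E] [Module ℝ E] (Q : TDProblem S A d)
    (f : S × A × S → E) : E :=
  ∑ z, Q.weight z • f z

/-- TD error `δ = r + γ φ'ᵀ θ - φᵀ θ` of a sample. -/
def tdError (Q : TDProblem S A d) (z : S × A × S) (θ : Vec d) : ℝ :=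
  Q.reward z.1 z.2.1 z.2.2 + Q.γ * ⟪Q.feat z.2.2, θ⟫ - ⟪Q.feat z.1, θ⟫

/-- The samples `Z 0, Z 1, …` are independent and each has the law `weight`. -/
structure IsIIDSample (Q : TDProblem S A d) {Ω : Type*} [MeasurableSpace Ω] (μ : Measure Ω)
    (Z : ℕ → Ω → S × A × S) : Prop where
  measurable : ∀ t z, MeasurableSet (Z t ⁻¹' {z})
  law : ∀ t z, μ.real (Z t ⁻¹' {z}) = Q.weight z
  indep : iIndepFun (m := fun _ => ⊤) Z μ

/-! ### Objectives and the saddle-point function -/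

/-- Norm of the expected TD update, `NEU(θ) = E[δ φ]ᵀ E[δ φ]`. -/
def NEU (Q : TDProblem S A d) (θ : Vec d) : ℝ :=
  ⟪Q.expect fun z => Q.tdError z θ • Q.feat z.1, Q.expect fun z => Q.tdError z θ • Q.feat z.1⟫

/-- Bellman operator `T V = R + γ P V`. -/
def bellman (Q : TDProblem S A d) (V : S → ℝ) : S → ℝ :=
  Q.rewardVec + Q.γ • (Q.transMat *ᵥ V)

/-- The `Ξ`-weighted projection `Π = Φ (Φᵀ Ξ Φ)⁻¹ Φᵀ Ξ` onto the span of the features. -/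
def projMat [DecidableEq S] (Q : TDProblem S A d) : Matrix S S ℝ :=
  Q.Φ * Q.gram⁻¹ * Q.Φᵀ * Q.Xi

/-- Mean-square projected Bellman error, `MSPBE(θ) = ‖Φ θ - Π T (Φ θ)‖²_Ξ`. -/
def MSPBE [DecidableEq S] (Q : TDProblem S A d) (θ : Vec d) : ℝ :=
  ∑ s, Q.ξ s * ((Q.Φ *ᵥ θ.ofLp - Q.projMat *ᵥ Q.bellman (Q.Φ *ᵥ θ.ofLp)) s) ^ 2

/-- Regularized objective: `NEU / 2 + h` for GTD and `MSPBE / 2 + h` for GTD2. -/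
def objective [DecidableEq S] (Q : TDProblem S A d) : GradTD → Vec d → ℝ
  | .gtd, θ => (1 / 2) * Q.NEU θ + Q.h θ
  | .gtd2, θ => (1 / 2) * Q.MSPBE θ + Q.h θ

/-- `F*`: half the squared Euclidean norm for GTD, half the squared `M`-norm for GTD2. -/
def Fstar [DecidableEq S] (Q : TDProblem S A d) : GradTD → Vec d → ℝ
  | .gtd, y => (1 / 2) * ‖y‖ ^ 2
  | .gtd2, y => (1 / 2) * (y.ofLp ⬝ᵥ (Q.gram *ᵥ y.ofLp))

/-- The saddle-point function `L(θ, y) = ⟨K(θ), y⟩ - F*(y) + h(θ)`. -/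
def saddle [DecidableEq S] (Q : TDProblem S A d) (alg : GradTD) (θ y : Vec d) : ℝ :=
  ⟪Q.K θ, y⟫ - Q.Fstar alg y + Q.h θ

/-- Duality gap `max_{y ∈ Y} L(θ, y) - min_{θ' ∈ X} L(θ', y')` of a pair `(θ, y')`. -/
def gap [DecidableEq S] (Q : TDProblem S A d) (alg : GradTD) (θ y' : Vec d) : ℝ :=
  (⨆ y : Q.Y, Q.saddle alg θ y) - ⨅ θ' : Q.X, Q.saddle alg θ' y'

/-! ### Stochastic oracles and the algorithms -/

/-- Oracle for `∇F*(y)`: `y` for GTD and `φ φᵀ y` for GTD2. -/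
def oracleF (Q : TDProblem S A d) : GradTD → S × A × S → Vec d → Vec d
  | .gtd, _, y => y
  | .gtd2, z, y => ⟪Q.feat z.1, y⟫ • Q.feat z.1

/-- Oracle for `K(θ)`: `δ φ`. -/
def oracleK (Q : TDProblem S A d) (z : S × A × S) (θ : Vec d) : Vec d :=
  Q.tdError z θ • Q.feat z.1

/-- Oracle for `∇K(θ)ᵀ y`: `-(φ - γ φ') (yᵀ φ)`. -/
def oracleKT (Q : TDProblem S A d) (z : S × A × S) (y : Vec d) : Vec d :=
  -(⟪y, Q.feat z.1⟫ • (Q.feat z.1 - Q.γ • Q.feat z.2.2))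

/-- The iterates `(θ_t, y_t)` along the samples `zs`, started at `(θ_0, y_0)`:
`y_{t+1} = proj_Y (y_t + α_t (δ_t φ_t - y_t))` for GTD,
`y_{t+1} = proj_Y (y_t + α_t (δ_t - φ_tᵀ y_t) φ_t)` for GTD2, and
`θ_{t+1} = prox_{α_t h} (θ_t + α_t (φ_t - γ φ'_t) (y_tᵀ φ_t))`, the minimum being over `X`. -/
def iterates (Q : TDProblem S A d) (alg : GradTD) (α : ℕ → ℝ) (θ₀ y₀ : Vec d)
    (zs : ℕ → S × A × S) : ℕ → Vec d × Vec d
  | 0 => (θ₀, y₀)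
  | t + 1 =>
    let θ := (iterates Q alg α θ₀ y₀ zs t).1
    let y := (iterates Q alg α θ₀ y₀ zs t).2
    (prox Q.X (fun p => α t * Q.h p) (θ - α t • Q.oracleKT (zs t) y),
      prox Q.Y (fun _ => 0) (y + α t • (Q.oracleK (zs t) θ - Q.oracleF alg (zs t) y)))

/-- The average of the first `N` computed iterates, `((1/N) ∑_{i=1}^N θ_i, (1/N) ∑_{i=1}^N y_i)`. -/
def average (Q : TDProblem S A d) (alg : GradTD) (α : ℕ → ℝ) (θ₀ y₀ : Vec d)
    (zs : ℕ → S × A × S) (N : ℕ) : Vec d × Vec d :=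
  (N : ℝ)⁻¹ • ∑ i ∈ Finset.Icc 1 N, Q.iterates alg α θ₀ y₀ zs i

/-- The variances of the three oracles are bounded on `X` and `Y` by the squares of the
non-negative constants `σF`, `σKθ`, `σKy`. -/
structure VarianceBound [DecidableEq S] (Q : TDProblem S A d) (alg : GradTD)
    (σF σKθ σKy : ℝ) : Prop where
  σF_nonneg : 0 ≤ σF
  σKθ_nonneg : 0 ≤ σKθ
  σKy_nonneg : 0 ≤ σKy
  boundF : ∀ y ∈ Q.Y,
    Q.expect (fun z => ‖Q.oracleF alg z y - gradient (Q.Fstar alg) y‖ ^ 2) ≤ σF ^ 2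
  boundK : ∀ θ ∈ Q.X, Q.expect (fun z => ‖Q.oracleK z θ - Q.K θ‖ ^ 2) ≤ σKθ ^ 2
  boundKT : ∀ θ ∈ Q.X, ∀ y ∈ Q.Y,
    Q.expect (fun z => ‖Q.oracleKT z y - gradient (fun θ' => ⟪Q.K θ', y⟫) θ‖ ^ 2) ≤ σKy ^ 2

/-- `L_{F*}`: `1` for GTD and the spectral norm of `Φᵀ Ξ Φ` for GTD2. -/
def LFstar [DecidableEq S] (Q : TDProblem S A d) : GradTD → ℝ
  | .gtd => 1
  | .gtd2 => ‖Matrix.toEuclideanCLM (𝕜 := ℝ) Q.gram‖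

/-- The spectral norm of `Φᵀ Ξ (Φ - γ Φ')`. -/
def normTD [DecidableEq S] (Q : TDProblem S A d) : ℝ :=
  ‖Matrix.toEuclideanCLM (𝕜 := ℝ) Q.tdMat‖

end TDProblem

/-- `σ = √(σ_{F*}² + σ_{K,θ}²) + σ_{K,y}`. -/
def noiseLevel (σF σKθ σKy : ℝ) : ℝ := √(σF ^ 2 + σKθ ^ 2) + σKy

/-- Step sizes of order `1 / √N` over the first `N` steps, at the scale `1 / Λ`: non-increasing with
`c₁ / (Λ √N) ≤ α_t ≤ c₂ / (Λ √(t+1))`. Both `α_t = c / (Λ √N)` and `α_t = c / (Λ √(t+1))` are of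
this kind with `c₁ = c₂ = c`. -/
structure StepRule (c₁ c₂ Λ : ℝ) (N : ℕ) (α : ℕ → ℝ) : Prop where
  antitone : ∀ t, t + 1 < N → α (t + 1) ≤ α t
  lower : ∀ t < N, c₁ ≤ α t * (Λ * √N)
  upper : ∀ t < N, α t * (Λ * √(t + 1)) ≤ c₂

/-- The σ-algebra generated by the samples `Z i` with `i < t`. -/
abbrev pastAlgebra {Ω α : Type*} (Z : ℕ → Ω → α) (t : ℕ) : MeasurableSpace Ω :=
  ⨆ i : Fin t, MeasurableSpace.comap (Z i) ⊤

end

/-! ### Functions of finitely many samples -/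

section Samples

variable {Ω T E : Type*}

/-! Write G for the Hessian of F* (the identity for GTD, M for GTD2) and B for the spectral norm of
Φᵀ Ξ (Φ - γ Φ'). Everything rests on K being affine in θ and F* being a convex quadratic.

Primal-dual form. L(θ, ·) is a concave quadratic, so a solution of G y = K(θ) is a global maximizer,
with value ⟨K(θ), y⟩ / 2 + h(θ). The solution is K(θ) for GTD and M⁻¹ K(θ) for GTD2. Since NEU(θ) =
‖K(θ)‖² and Φθ - ΠTΦθ = -Φ M⁻¹ K(θ), these values are the two objectives (`isGreatest_saddle`).

Unbiasedness. There are finitely many possible samples, and the iterates at time t are functions of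
the earlier ones; conditioning on the past therefore averages over the law of the current sample
(`condExp_sample`).

Rate. The variational inequalities of the two proximal steps bound L(θ_{t+1}, v) - L(u, y_{t+1}) by
differences of squared distances over 2α_t, by α_t times squared Lipschitz constants and squared
noise, and by noise paired with (y_t - v, u - θ_t) (`saddle_step`). Summation by parts gives
D²/α_{N-1} = O(Λ√N), and the sum of the α_t is O(√N/Λ). The maximum over (u, v) stands inside the
expectation, so the comparison point may depend on the noise. Hence y_t - v is split at y₀: the
pairing with y_t - y₀ has mean zero, and the rest is at most D times the norm of the summed noise,
uniformly in v (`gap_average_le`). Centred terms are orthogonal, so that norm is O(σ√N) in mean.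
Jensen and division by N give Λ/√N, once B = O(Λ) is known (`normTD_le_two_mul`). -/

lemma measurable_past {T : Type*} [MeasurableSpace T] (Z : ℕ → Ω → T) (t : ℕ) :
    Measurable[pastAlgebra Z t] fun ω (i : Fin t) => Z i ω := by
  refine @measurable_pi_lambda _ _ _ (pastAlgebra Z t) _ _ fun i => ?_
  intro s _
  exact MeasurableSpace.le_def.1
    (le_iSup (fun i : Fin t => MeasurableSpace.comap (Z i) ⊤) i) _ ⟨s, trivial, rfl⟩

/-- For finite `T` the domain of `g` is finite, so measurability and boundedness are automatic; no
regularity of the proximal maps or of the gap is ever needed. -/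
lemma exists_factor_of_dependsOn [Nonempty T] {t : ℕ} {f : (ℕ → T) → E}
    (hf : DependsOn f (Set.Iio t)) :
    ∃ g : (Fin t → T) → E, ∀ zs, f zs = g fun i => zs i := by
  classical
  refine ⟨fun p => f fun n => if hn : n < t then p ⟨n, hn⟩ else Classical.arbitrary T,
    fun zs => hf fun i hi => ?_⟩
  have : i < t := hi
  simp [this]

lemma stronglyMeasurable_past_of_dependsOn [Finite T] [Nonempty T] [TopologicalSpace E]
    (Z : ℕ → Ω → T) {t : ℕ} {f : (ℕ → T) → E} (hf : DependsOn f (Set.Iio t)) :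
    StronglyMeasurable[pastAlgebra Z t] fun ω => f fun i => Z i ω := by
  let _ : MeasurableSpace T := ⊤
  obtain ⟨g, hg⟩ := exists_factor_of_dependsOn hf
  simp_rw [hg]
  exact (StronglyMeasurable.of_discrete (f := g)).comp_measurable (measurable_past Z t)

variable [MeasurableSpace Ω] {μ : Measure Ω}

lemma measurable_top_of_preimage_singleton [Finite T] {X : Ω → T}
    (hX : ∀ z, MeasurableSet (X ⁻¹' {z})) : Measurable[_, ⊤] X := by
  let _ : MeasurableSpace T := ⊤
  exact measurable_to_countable' hX

lemma pastAlgebra_le [Finite T] {Z : ℕ → Ω → T}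
    (hZ : ∀ t z, MeasurableSet (Z t ⁻¹' {z})) (t : ℕ) : pastAlgebra Z t ≤ ‹MeasurableSpace Ω› :=
  iSup_le fun i => (measurable_top_of_preimage_singleton (hZ i)).comap_le

lemma integrable_of_dependsOn [Finite T] [Nonempty T] [NormedAddCommGroup E] [IsFiniteMeasure μ]
    {Z : ℕ → Ω → T} (hZ : ∀ t z, MeasurableSet (Z t ⁻¹' {z})) {t : ℕ} {f : (ℕ → T) → E}
    (hf : DependsOn f (Set.Iio t)) : Integrable (fun ω => f fun i => Z i ω) μ := by
  obtain ⟨g, hg⟩ := exists_factor_of_dependsOn hf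
  obtain ⟨C, hC⟩ := (Set.finite_range fun p => ‖g p‖).bddAbove
  refine Integrable.of_bound
    ((stronglyMeasurable_past_of_dependsOn Z hf).mono (pastAlgebra_le hZ t)).aestronglyMeasurable
    C (.of_forall fun ω => ?_)
  rw [hg]
  exact hC ⟨_, rfl⟩

/-- The samples before time `t` are independent of the sample at time `t`. -/
lemma indep_pastAlgebra [Finite T] [IsProbabilityMeasure μ] {Z : ℕ → Ω → T}
    (hZ : ∀ t z, MeasurableSet (Z t ⁻¹' {z})) (hind : iIndepFun (m := fun _ => ⊤) Z μ) (t : ℕ) :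
    Indep (MeasurableSpace.comap (Z t) ⊤) (pastAlgebra Z t) μ := by
  have h := indep_iSup_of_disjoint (μ := μ) (m := fun i => MeasurableSpace.comap (Z i) ⊤)
    (fun i => (measurable_top_of_preimage_singleton (hZ i)).comap_le) hind
    (S := {t}) (T := Set.Iio t) (by simp)
  refine indep_of_indep_of_le_right (indep_of_indep_of_le_left h ?_) ?_
  · exact le_iSup₂_of_le t rfl le_rfl
  · exact iSup_le fun i => le_iSup₂_of_le (i : ℕ) i.2 le_rfl

/-- Given the past, the mean of a function of the current sample and the past is the average over
the law of the current sample. -/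
lemma condExp_sample [Fintype T] [Nonempty T] [NormedAddCommGroup E] [NormedSpace ℝ E]
    [CompleteSpace E] [IsProbabilityMeasure μ] {Z : ℕ → Ω → T} {w : T → ℝ}
    (hZ : ∀ t z, MeasurableSet (Z t ⁻¹' {z})) (hw : ∀ t z, μ.real (Z t ⁻¹' {z}) = w z)
    (hind : iIndepFun (m := fun _ => ⊤) Z μ) {t : ℕ} {f : T → (ℕ → T) → E}
    (hf : ∀ z, DependsOn (f z) (Set.Iio t)) :
    μ[fun ω => f (Z t ω) fun i => Z i ω | pastAlgebra Z t]
      =ᵐ[μ] fun ω => ∑ z, w z • f z fun i => Z i ω := by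
  classical
  have hle := pastAlgebra_le hZ t
  -- Splitting by the value of the current sample separates it from the past: each summand is an
  -- indicator of the present times a function of the past.
  have hsplit : (fun ω => f (Z t ω) fun i => Z i ω)
      = ∑ z, fun ω => (Z t ⁻¹' {z}).indicator (fun _ => (1 : ℝ)) ω • f z fun i => Z i ω := by
    funext ω
    simp [Finset.sum_apply, Set.indicator_apply, ite_smul]
  have hint1 : ∀ z, Integrable ((Z t ⁻¹' {z}).indicator fun _ => (1 : ℝ)) μ := fun z =>
    (integrable_const 1).indicator (hZ t z)
  have hint : ∀ z, Integrable
      (fun ω => (Z t ⁻¹' {z}).indicator (fun _ => (1 : ℝ)) ω • f z fun i => Z i ω) μ := by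
    intro z
    have := (integrable_of_dependsOn (μ := μ) hZ (hf z)).indicator (hZ t z)
    refine this.congr (.of_forall fun ω => ?_)
    by_cases h : ω ∈ Z t ⁻¹' {z} <;> simp [Set.indicator, h]
  rw [hsplit]
  refine (condExp_finsetSum (fun z _ => hint z) _).trans ?_
  have hz : ∀ z, μ[fun ω => (Z t ⁻¹' {z}).indicator (fun _ => (1 : ℝ)) ω • f z fun i => Z i ω |
      pastAlgebra Z t] =ᵐ[μ] fun ω => w z • f z fun i => Z i ω := by
    intro z
    refine (condExp_smul_of_aestronglyMeasurable_right (hint1 z) (hint z)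
      (stronglyMeasurable_past_of_dependsOn Z (hf z)).aestronglyMeasurable).trans ?_
    -- The indicator is independent of the past, so its conditional expectation is the constant `w
    -- z`.
    have hc : μ[(Z t ⁻¹' {z}).indicator (fun _ => (1 : ℝ)) | pastAlgebra Z t]
        =ᵐ[μ] fun _ => ∫ ω, (Z t ⁻¹' {z}).indicator (fun _ => (1 : ℝ)) ω ∂μ := by
      refine condExp_indep_eq (m₁ := MeasurableSpace.comap (Z t) ⊤)
        (measurable_top_of_preimage_singleton (hZ t)).comap_le hle ?_ (indep_pastAlgebra hZ hind t)
      exact StronglyMeasurable.indicator stronglyMeasurable_const ⟨{z}, trivial, rfl⟩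
    filter_upwards [hc] with ω hω
    simp only [Pi.smul_apply', hω]
    rw [integral_indicator_const _ (hZ t z), hw]
    simp
  have hall : ∀ᵐ ω ∂μ, ∀ z, (μ[fun ω => (Z t ⁻¹' {z}).indicator (fun _ => (1 : ℝ)) ω •
      f z fun i => Z i ω | pastAlgebra Z t]) ω = w z • f z fun i => Z i ω :=
    ae_all_iff.2 hz
  filter_upwards [hall] with ω hω
  simp [Finset.sum_apply, hω]

lemma integral_sample [Fintype T] [Nonempty T] [NormedAddCommGroup E] [NormedSpace ℝ E]
    [CompleteSpace E] [IsProbabilityMeasure μ] {Z : ℕ → Ω → T} {w : T → ℝ}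
    (hZ : ∀ t z, MeasurableSet (Z t ⁻¹' {z})) (hw : ∀ t z, μ.real (Z t ⁻¹' {z}) = w z)
    (hind : iIndepFun (m := fun _ => ⊤) Z μ) {t : ℕ} {f : T → (ℕ → T) → E}
    (hf : ∀ z, DependsOn (f z) (Set.Iio t)) :
    ∫ ω, f (Z t ω) (fun i => Z i ω) ∂μ = ∫ ω, ∑ z, w z • f z (fun i => Z i ω) ∂μ := by
  rw [← integral_condExp (pastAlgebra_le hZ t)]
  exact integral_congr_ae (condExp_sample hZ hw hind hf)

end Samples

/-! ### Expectations, gradients and the primal-dual form -/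

/-- All functions differentiated below are quadratic or affine, so their first-order remainder is
explicit and such a bound is immediate. -/
lemma hasGradientAt_of_sq_bound {E : Type*} [NormedAddCommGroup E] [InnerProductSpace ℝ E]
    [CompleteSpace E] {f : E → ℝ} {g x : E} (C : ℝ)
    (h : ∀ x', |f x' - f x - ⟪g, x' - x⟫| ≤ C * ‖x' - x‖ ^ 2) : HasGradientAt f g x := by
  rw [hasGradientAt_iff_isLittleO]
  have h1 : (fun x' => f x' - f x - ⟪g, x' - x⟫) =O[nhds x] fun x' => ‖x' - x‖ ^ 2 :=
    Asymptotics.IsBigO.of_bound C (.of_forall fun x' => by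
      simpa [Real.norm_eq_abs] using h x')
  refine h1.trans_isLittleO ?_
  have h2 : Filter.Tendsto (fun x' => x' - x) (nhds x) (nhds 0) := by
    have : ContinuousAt (fun x' => x' - x) x := by fun_prop
    simpa [ContinuousAt] using this
  exact (Asymptotics.isLittleO_norm_pow_id one_lt_two).comp_tendsto h2

namespace TDProblem

variable {S A : Type*} [Fintype S] [Fintype A] {d : ℕ} (Q : TDProblem S A d)

lemma weight_nonneg (z : S × A × S) : 0 ≤ Q.weight z :=
  mul_nonneg (mul_nonneg (Q.ξ_pos _).le (Q.policy_nonneg _ _)) (Q.P_nonneg _ _ _)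

lemma expect_real (f : S × A × S → ℝ) :
    Q.expect f = ∑ s, Q.ξ s * ∑ a, ∑ s', Q.policy s a * Q.P s a s' * f (s, a, s') := by
  simp only [expect, weight, Fintype.sum_prod_type, Finset.mul_sum, smul_eq_mul, mul_assoc]

lemma expect_state (f : S → ℝ) : Q.expect (fun z => f z.1) = ∑ s, Q.ξ s * f s := by
  rw [expect_real]
  refine Finset.sum_congr rfl fun s _ => ?_
  simp_rw [← Finset.sum_mul, ← Finset.mul_sum, Q.P_sum, mul_one, Q.policy_sum, one_mul]

lemma sum_weight : ∑ z, Q.weight z = 1 := by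
  have := Q.expect_state fun _ => 1
  simpa [expect, Q.ξ_sum] using this

lemma nonempty_state (Q : TDProblem S A d) : Nonempty S := by
  by_contra h
  rw [not_nonempty_iff] at h
  simpa using Q.ξ_sum

lemma nonempty_action (Q : TDProblem S A d) : Nonempty A := by
  obtain ⟨s⟩ := Q.nonempty_state
  by_contra h
  rw [not_nonempty_iff] at h
  simpa using Q.policy_sum s

lemma inner_expect (y : Vec d) (f : S × A × S → Vec d) :
    ⟪y, Q.expect f⟫ = Q.expect fun z => ⟪y, f z⟫ := by
  simp [expect, inner_sum, inner_smul_right]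

lemma expect_add {E : Type*} [AddCommGroup E] [Module ℝ E] (f g : S × A × S → E) :
    Q.expect (fun z => f z + g z) = Q.expect f + Q.expect g := by
  simp [expect, Finset.sum_add_distrib]

lemma expect_sub {E : Type*} [AddCommGroup E] [Module ℝ E] (f g : S × A × S → E) :
    Q.expect (fun z => f z - g z) = Q.expect f - Q.expect g := by
  simp [expect, smul_sub]

lemma expect_const {E : Type*} [AddCommGroup E] [Module ℝ E] (c : E) :
    Q.expect (fun _ => c) = c := by
  simp [expect, ← Finset.sum_smul, Q.sum_weight]

lemma expect_mul_left (c : ℝ) (f : S × A × S → ℝ) :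
    Q.expect (fun z => c * f z) = c * Q.expect f := by
  simp only [expect, Finset.mul_sum, smul_eq_mul]
  exact Finset.sum_congr rfl fun z _ => by ring

lemma expect_mono {f g : S × A × S → ℝ} (h : ∀ z, f z ≤ g z) : Q.expect f ≤ Q.expect g :=
  Finset.sum_le_sum fun z _ => mul_le_mul_of_nonneg_left (h z) (Q.weight_nonneg z)

lemma inner_feat (s : S) (x : Vec d) : ⟪Q.feat s, x⟫ = (Q.Φ *ᵥ x.ofLp) s := by
  simp [feat, Matrix.mulVec, dotProduct, PiLp.inner_apply, mul_comm]

lemma mean_reward_next (s : S) (θ : Vec d) :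
    (Q.rewardVec + Q.γ • (Q.PhiNext *ᵥ θ.ofLp) - Q.Φ *ᵥ θ.ofLp) s
      = ∑ a, ∑ s', Q.policy s a * Q.P s a s' * Q.tdError (s, a, s') θ := by
  have h1 : (Q.PhiNext *ᵥ θ.ofLp) s
      = ∑ a, ∑ s', Q.policy s a * Q.P s a s' * ⟪Q.feat s', θ⟫ := by
    rw [PhiNext, ← Matrix.mulVec_mulVec, Matrix.mulVec, dotProduct, Finset.sum_comm]
    simp [transMat, Finset.sum_mul, inner_feat]
  -- A term not depending on (a, s') equals its own mean; this puts all three parts of the TD error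
  -- under one sum.
  have h2 : ⟪Q.feat s, θ⟫ = ∑ a, ∑ s', Q.policy s a * Q.P s a s' * ⟪Q.feat s, θ⟫ := by
    simp_rw [← Finset.sum_mul, ← Finset.mul_sum, Q.P_sum, mul_one, Q.policy_sum, one_mul]
  have h3 : (Q.Φ *ᵥ θ.ofLp) s = ∑ a, ∑ s', Q.policy s a * Q.P s a s' * ⟪Q.feat s, θ⟫ := by
    rw [← h2, inner_feat]
  simp only [Pi.add_apply, Pi.sub_apply, Pi.smul_apply, h1, h3, smul_eq_mul, rewardVec,
    Finset.mul_sum, ← Finset.sum_add_distrib, ← Finset.sum_sub_distrib, tdError]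
  refine Finset.sum_congr rfl fun a _ => Finset.sum_congr rfl fun s' _ => by ring

/-- Stationarity says that the successor state has the same marginal ξ as the current state. -/
lemma expect_next (hQ : Q.IsStationary) (f : S → ℝ) :
    Q.expect (fun z => f z.2.2) = ∑ s, Q.ξ s * f s := by
  have h : ∀ s', ∑ s, Q.ξ s * ∑ a, Q.policy s a * Q.P s a s' = Q.ξ s' := fun s' => congrFun hQ s'
  rw [expect_real]
  have h' : ∑ s', Q.ξ s' * f s' = ∑ s', (∑ s, Q.ξ s * ∑ a, Q.policy s a * Q.P s a s') * f s' :=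
    Finset.sum_congr rfl fun s' _ => by rw [h]
  rw [h']
  simp only [Finset.sum_mul, Finset.mul_sum]
  rw [Finset.sum_comm (s := Finset.univ (α := S)) (t := Finset.univ (α := S))]
  refine Finset.sum_congr rfl fun s _ => ?_
  rw [Finset.sum_comm]
  exact Finset.sum_congr rfl fun s' _ => Finset.sum_congr rfl fun a _ => by ring

variable [DecidableEq S]

/-- Tested against a vector, the matrix expressions become ξ-weighted sums; this is the bridge to
expectations over a sample. -/
lemma inner_weighted (x : Vec d) (V : S → ℝ) :
    ⟪x, (WithLp.toLp 2 ((Q.Φᵀ * Q.Xi) *ᵥ V) : Vec d)⟫ = ∑ s, Q.ξ s * (⟪Q.feat s, x⟫ * V s) := by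
  have : ⟪x, (WithLp.toLp 2 ((Q.Φᵀ * Q.Xi) *ᵥ V) : Vec d)⟫
      = ((Q.Φᵀ * Q.Xi) *ᵥ V) ⬝ᵥ x.ofLp := by
    simp [PiLp.inner_apply, dotProduct]
  rw [this, ← Matrix.mulVec_mulVec, dotProduct_comm, Matrix.dotProduct_mulVec, Matrix.vecMul_transpose]
  simp only [Xi, dotProduct, Matrix.mulVec_diagonal, inner_feat]
  exact Finset.sum_congr rfl fun s _ => by ring

lemma expect_oracleK (θ : Vec d) : Q.expect (fun z => Q.oracleK z θ) = Q.K θ := by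
  refine ext_inner_left ℝ fun y => ?_
  rw [inner_expect, K, inner_weighted, expect_real]
  refine Finset.sum_congr rfl fun s _ => ?_
  rw [mean_reward_next]
  congr 1
  rw [Finset.mul_sum]
  refine Finset.sum_congr rfl fun a _ => ?_
  rw [Finset.mul_sum]
  refine Finset.sum_congr rfl fun s' _ => ?_
  simp only [oracleK, inner_smul_right, real_inner_comm (Q.feat s) y]
  ring

/-- K is affine in θ; the mean of the third oracle is the adjoint of its linear part applied to y,
hence the θ-gradient of the pairing. -/
lemma inner_K (θ y : Vec d) :
    ⟪Q.K θ, y⟫ = ⟪Q.K 0, y⟫ + ⟪θ, Q.expect fun z => Q.oracleKT z y⟫ := by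
  rw [← expect_oracleK, ← expect_oracleK, real_inner_comm, real_inner_comm y, inner_expect,
    inner_expect, inner_expect, ← expect_add]
  congr 1
  funext z
  simp only [oracleK, oracleKT, tdError, inner_smul_right, inner_neg_right, inner_sub_right,
    inner_zero_right, real_inner_comm θ]
  ring

/-- The Hessian of `F*`: the identity for GTD and `M` for GTD2. -/
noncomputable def dualHess : GradTD → Vec d →L[ℝ] Vec d
  | .gtd => ContinuousLinearMap.id ℝ _
  | .gtd2 => Matrix.toEuclideanCLM (𝕜 := ℝ) Q.gram

lemma toEuclideanCLM_gram (y : Vec d) : Matrix.toEuclideanCLM (𝕜 := ℝ) Q.gram y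
    = WithLp.toLp 2 ((Q.Φᵀ * Q.Xi) *ᵥ (Q.Φ *ᵥ y.ofLp)) := by
  rw [Matrix.mulVec_mulVec]; rfl

lemma inner_gram (x y : Vec d) : ⟪x, Matrix.toEuclideanCLM (𝕜 := ℝ) Q.gram y⟫
    = Q.expect fun z => ⟪Q.feat z.1, x⟫ * ⟪Q.feat z.1, y⟫ := by
  rw [toEuclideanCLM_gram, inner_weighted,
    Q.expect_state fun s => ⟪Q.feat s, x⟫ * ⟪Q.feat s, y⟫]
  simp only [inner_feat]

lemma K_sub (θ θ' : Vec d) :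
    Q.K θ - Q.K θ' = -Matrix.toEuclideanCLM (𝕜 := ℝ) Q.tdMat (θ - θ') := by
  have : Matrix.toEuclideanCLM (𝕜 := ℝ) Q.tdMat (θ - θ')
      = WithLp.toLp 2 (Q.tdMat *ᵥ (θ.ofLp - θ'.ofLp)) := rfl
  rw [this, K, K, ← WithLp.toLp_sub, ← WithLp.toLp_neg, tdMat, ← Matrix.mulVec_sub,
    ← Matrix.mulVec_mulVec _ (Q.Φᵀ * Q.Xi), ← Matrix.mulVec_neg]
  refine congrArg (fun V => (WithLp.toLp 2 ((Q.Φᵀ * Q.Xi) *ᵥ V) : Vec d)) ?_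
  simp only [Matrix.sub_mulVec, Matrix.smul_mulVec, Matrix.mulVec_sub]
  module

lemma norm_K_sub_le (θ θ' : Vec d) : ‖Q.K θ - Q.K θ'‖ ≤ Q.normTD * ‖θ - θ'‖ := by
  rw [K_sub, norm_neg]
  exact ContinuousLinearMap.le_opNorm _ _

lemma expect_oracleF (alg : GradTD) (y : Vec d) :
    Q.expect (fun z => Q.oracleF alg z y) = Q.dualHess alg y := by
  cases alg
  · simp only [oracleF, expect_const, dualHess, ContinuousLinearMap.id_apply]
  · refine ext_inner_left ℝ fun x => ?_
    rw [inner_expect, dualHess, inner_gram]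
    simp only [oracleF, inner_smul_right, real_inner_comm x, mul_comm]

lemma inner_dualHess_comm (alg : GradTD) (x y : Vec d) :
    ⟪x, Q.dualHess alg y⟫ = ⟪y, Q.dualHess alg x⟫ := by
  cases alg
  · exact real_inner_comm _ _
  · simp only [dualHess, inner_gram, mul_comm]

lemma inner_dualHess_nonneg (alg : GradTD) (x : Vec d) : 0 ≤ ⟪x, Q.dualHess alg x⟫ := by
  cases alg
  · exact real_inner_self_nonneg
  · simp only [dualHess, inner_gram]
    exact Finset.sum_nonneg fun z _ => smul_nonneg (Q.weight_nonneg z) (mul_self_nonneg _)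

lemma norm_dualHess_le (alg : GradTD) (x : Vec d) : ‖Q.dualHess alg x‖ ≤ Q.LFstar alg * ‖x‖ := by
  cases alg
  · simp [dualHess, LFstar]
  · exact ContinuousLinearMap.le_opNorm _ _

lemma LFstar_nonneg (alg : GradTD) : 0 ≤ Q.LFstar alg := by
  cases alg
  · exact zero_le_one
  · exact norm_nonneg _

lemma Fstar_eq (alg : GradTD) (y : Vec d) :
    Q.Fstar alg y = (1 / 2) * ⟪y, Q.dualHess alg y⟫ := by
  cases alg
  · simp [Fstar, dualHess]
  · have : ⟪y, Q.dualHess .gtd2 y⟫ = y.ofLp ⬝ᵥ (Q.gram *ᵥ y.ofLp) := by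
      change ⟪y, (WithLp.toLp 2 (Q.gram *ᵥ y.ofLp) : Vec d)⟫ = _
      simp [PiLp.inner_apply, dotProduct, mul_comm]
    rw [this, Fstar]

lemma saddle_eq (alg : GradTD) (θ y : Vec d) :
    Q.saddle alg θ y = ⟪Q.K θ, y⟫ - (1 / 2) * ⟪y, Q.dualHess alg y⟫ + Q.h θ := by
  rw [saddle, Fstar_eq]

lemma inner_dualHess_expand (alg : GradTD) (x y : Vec d) :
    ⟪x, Q.dualHess alg x⟫ = ⟪y, Q.dualHess alg y⟫ + 2 * ⟪Q.dualHess alg y, x - y⟫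
      + ⟪x - y, Q.dualHess alg (x - y)⟫ := by
  have := Q.inner_dualHess_comm alg x y
  simp only [map_sub, inner_sub_left, inner_sub_right, real_inner_comm _ (Q.dualHess alg y)]
  linarith

lemma abs_inner_dualHess_le (alg : GradTD) (x : Vec d) :
    |⟪x, Q.dualHess alg x⟫| ≤ Q.LFstar alg * ‖x‖ ^ 2 := by
  refine (abs_real_inner_le_norm _ _).trans ?_
  nlinarith [Q.norm_dualHess_le alg x, norm_nonneg x]

lemma hasGradientAt_Fstar (alg : GradTD) (y : Vec d) :
    HasGradientAt (Q.Fstar alg) (Q.dualHess alg y) y := by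
  refine hasGradientAt_of_sq_bound (Q.LFstar alg) fun x => ?_
  have h : Q.Fstar alg x - Q.Fstar alg y - ⟪Q.dualHess alg y, x - y⟫
      = (1 / 2) * ⟪x - y, Q.dualHess alg (x - y)⟫ := by
    rw [Fstar_eq, Fstar_eq, Q.inner_dualHess_expand alg x y]; ring
  rw [h, abs_mul, abs_of_pos one_half_pos]
  linarith [Q.abs_inner_dualHess_le alg (x - y), abs_nonneg ⟪x - y, Q.dualHess alg (x - y)⟫]

lemma hasGradientAt_inner_K (θ y : Vec d) :
    HasGradientAt (fun θ' => ⟪Q.K θ', y⟫) (Q.expect fun z => Q.oracleKT z y) θ := by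
  refine hasGradientAt_of_sq_bound 0 fun x => ?_
  have h : ⟪Q.K x, y⟫ - ⟪Q.K θ, y⟫ - ⟪Q.expect fun z => Q.oracleKT z y, x - θ⟫ = 0 := by
    rw [Q.inner_K x, Q.inner_K θ, real_inner_comm (x - θ), inner_sub_left]; ring
  simp [h]

lemma hasGradientAt_saddle (alg : GradTD) (θ y : Vec d) :
    HasGradientAt (Q.saddle alg θ) (Q.expect fun z => Q.oracleK z θ - Q.oracleF alg z y) y := by
  rw [expect_sub, expect_oracleK, expect_oracleF]
  refine hasGradientAt_of_sq_bound (Q.LFstar alg) fun x => ?_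
  have h : Q.saddle alg θ x - Q.saddle alg θ y - ⟪Q.K θ - Q.dualHess alg y, x - y⟫
      = -((1 / 2) * ⟪x - y, Q.dualHess alg (x - y)⟫) := by
    rw [saddle_eq, saddle_eq, Q.inner_dualHess_expand alg x y,
      inner_sub_left (Q.K θ), inner_sub_right (Q.K θ)]
    ring
  rw [h, abs_neg, abs_mul, abs_of_pos one_half_pos]
  linarith [Q.abs_inner_dualHess_le alg (x - y), abs_nonneg ⟪x - y, Q.dualHess alg (x - y)⟫]

/-- If M x = 0 then xᵀ M x = ∑ ξ(s) (Φ x)(s)² vanishes; positivity of ξ gives Φ x = 0, and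
independence of the columns gives x = 0. -/
lemma isUnit_gram : IsUnit Q.gram.det := by
  rw [← Matrix.isUnit_iff_isUnit_det, ← Matrix.mulVec_injective_iff_isUnit]
  refine (injective_iff_map_eq_zero (Matrix.mulVecLin Q.gram)).2 fun x hx => ?_
  have h0 : ⟪(WithLp.toLp 2 x : Vec d),
      Matrix.toEuclideanCLM (𝕜 := ℝ) Q.gram (WithLp.toLp 2 x)⟫ = 0 := by
    have : Matrix.toEuclideanCLM (𝕜 := ℝ) Q.gram (WithLp.toLp 2 x) = 0 :=
      congrArg (WithLp.toLp 2) hx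
    rw [this, inner_zero_right]
  rw [inner_gram, Q.expect_state fun s => ⟪Q.feat s, _⟫ * ⟪Q.feat s, _⟫,
    Finset.sum_eq_zero_iff_of_nonneg
      fun s _ => mul_nonneg (Q.ξ_pos s).le (mul_self_nonneg _)] at h0
  have h1 : Q.Φ *ᵥ x = 0 := by
    funext s
    simpa [(Q.ξ_pos s).ne', inner_feat] using h0 s (Finset.mem_univ s)
  exact Matrix.mulVec_injective_iff.2 Q.Φ_rank (h1.trans (Matrix.mulVec_zero _).symm)

/-- Completing the square: the two values differ by ⟨x - y, G (x - y)⟩ / 2. -/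
lemma saddle_le_of_critical (alg : GradTD) {θ y : Vec d} (hy : Q.dualHess alg y = Q.K θ)
    (x : Vec d) : Q.saddle alg θ x ≤ Q.saddle alg θ y := by
  have h := Q.inner_dualHess_expand alg x y
  have h1 := Q.inner_dualHess_nonneg alg (x - y)
  rw [saddle_eq, saddle_eq]
  rw [hy, inner_sub_right, real_inner_comm (Q.K θ) y] at h
  rw [hy, real_inner_comm (Q.K θ) y]
  linarith

lemma NEU_eq (θ : Vec d) : Q.NEU θ = ⟪Q.K θ, Q.K θ⟫ := by
  rw [NEU, ← expect_oracleK]; rfl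

/-- The solution `M⁻¹ K(θ)` of the normal equations. -/
noncomputable def gramSolution (θ : Vec d) : Vec d := WithLp.toLp 2 (Q.gram⁻¹ *ᵥ (Q.K θ).ofLp)

lemma dualHess_gramSolution (θ : Vec d) : Q.dualHess .gtd2 (Q.gramSolution θ) = Q.K θ := by
  change (WithLp.toLp 2 (Q.gram *ᵥ (Q.gram⁻¹ *ᵥ (Q.K θ).ofLp)) : Vec d) = _
  rw [Matrix.mulVec_mulVec, Matrix.mul_nonsing_inv _ Q.isUnit_gram, Matrix.one_mulVec]

lemma MSPBE_eq (θ : Vec d) : Q.MSPBE θ = ⟪Q.K θ, Q.gramSolution θ⟫ := by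
  have h : Q.Φ *ᵥ θ.ofLp - Q.projMat *ᵥ Q.bellman (Q.Φ *ᵥ θ.ofLp)
      = -(Q.Φ *ᵥ (Q.gramSolution θ).ofLp) := by
    have h1 : (Q.K θ).ofLp = (Q.Φᵀ * Q.Xi) *ᵥ (Q.bellman (Q.Φ *ᵥ θ.ofLp))
        - Q.gram *ᵥ θ.ofLp := by
      rw [K, bellman, gram, PhiNext, Matrix.mulVec_sub, Matrix.mulVec_mulVec, Matrix.mulVec_mulVec]
    simp only [gramSolution, h1, Matrix.mulVec_sub, Matrix.mulVec_mulVec, projMat,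
      Matrix.nonsing_inv_mul _ Q.isUnit_gram, Matrix.mul_assoc, Matrix.mul_one]
    module
  rw [← dualHess_gramSolution, real_inner_comm, dualHess, inner_gram,
    Q.expect_state fun s => ⟪Q.feat s, _⟫ * ⟪Q.feat s, _⟫, MSPBE, h]
  refine Finset.sum_congr rfl fun s _ => ?_
  rw [inner_feat, Pi.neg_apply]; ring

lemma isGreatest_saddle (alg : GradTD) (θ : Vec d) :
    IsGreatest (Set.range (Q.saddle alg θ)) (Q.objective alg θ) := by
  have key : ∃ y, Q.dualHess alg y = Q.K θ ∧ Q.objective alg θ = (1 / 2) * ⟪Q.K θ, y⟫ + Q.h θ := by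
    cases alg
    · exact ⟨Q.K θ, rfl, by rw [objective, NEU_eq]⟩
    · exact ⟨_, Q.dualHess_gramSolution θ, by rw [objective, MSPBE_eq]⟩
  obtain ⟨y, hy, hobj⟩ := key
  have h1 : Q.objective alg θ = Q.saddle alg θ y := by
    rw [hobj, saddle_eq, hy, real_inner_comm]; ring
  rw [h1]
  exact ⟨⟨y, rfl⟩, Set.forall_mem_range.2 (Q.saddle_le_of_critical alg hy)⟩

lemma inner_tdMat (x y : Vec d) : ⟪y, Matrix.toEuclideanCLM (𝕜 := ℝ) Q.tdMat x⟫
    = Q.expect fun z => ⟪Q.feat z.1, y⟫ * (⟪Q.feat z.1, x⟫ - Q.γ * ⟪Q.feat z.2.2, x⟫) := by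
  have h := Q.K_sub x 0
  rw [sub_zero] at h
  rw [← neg_neg (Matrix.toEuclideanCLM (𝕜 := ℝ) Q.tdMat x), ← h, inner_neg_right, inner_sub_right,
    ← expect_oracleK, ← expect_oracleK, inner_expect, inner_expect, ← expect_sub, ← neg_one_mul,
    ← expect_mul_left]
  congr 1
  funext z
  simp only [oracleK, tdError, inner_smul_right, inner_zero_right, real_inner_comm y]
  ring

/-- The bilinear form is E[(φᵀy)(φᵀx - γ φ'ᵀx)]. Under stationarity φ and φ' have the same second
moments, so Young's inequality for each sample bounds it by xᵀMx + yᵀMy. -/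
lemma normTD_le (hQ : Q.IsStationary) : Q.normTD ≤ 2 * Q.LFstar .gtd2 := by
  set G := Matrix.toEuclideanCLM (𝕜 := ℝ) Q.gram with hG
  set B := Matrix.toEuclideanCLM (𝕜 := ℝ) Q.tdMat with hB
  have hsq : ∀ x : Vec d, ⟪x, G x⟫ ≤ ‖G‖ * ‖x‖ ^ 2 := fun x =>
    (le_abs_self _).trans (Q.abs_inner_dualHess_le .gtd2 x)
  have hbil : ∀ x y : Vec d, ⟪y, B x⟫ ≤ ‖G‖ * ‖x‖ ^ 2 + ‖G‖ * ‖y‖ ^ 2 := by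
    intro x y
    refine le_trans ?_ (add_le_add (hsq x) (hsq y))
    -- One half of xᵀMx is read at the current state and one half at the successor, matching the two
    -- products to be estimated.
    have hx : ⟪x, G x⟫ = (1 / 2) * Q.expect (fun z => ⟪Q.feat z.1, x⟫ ^ 2)
        + (1 / 2) * Q.expect (fun z => ⟪Q.feat z.2.2, x⟫ ^ 2) := by
      rw [hG, inner_gram, Q.expect_next hQ fun s => ⟪Q.feat s, x⟫ ^ 2,
        Q.expect_state fun s => ⟪Q.feat s, x⟫ ^ 2,
        Q.expect_state fun s => ⟪Q.feat s, x⟫ * ⟪Q.feat s, x⟫]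
      simp only [← pow_two]
      ring
    rw [hx, hB, hG, inner_tdMat, inner_gram, ← expect_mul_left, ← expect_mul_left, ← expect_add,
      ← expect_add]
    refine Q.expect_mono fun z => ?_
    have h0 := Q.γ_nonneg
    have h1 := Q.γ_lt_one.le
    nlinarith [sq_nonneg (⟪Q.feat z.1, y⟫ - ⟪Q.feat z.1, x⟫),
      mul_nonneg h0 (sq_nonneg (⟪Q.feat z.1, y⟫ + ⟪Q.feat z.2.2, x⟫)),
      mul_nonneg (sub_nonneg.2 h1) (sq_nonneg ⟪Q.feat z.1, y⟫),
      mul_nonneg (sub_nonneg.2 h1) (sq_nonneg ⟪Q.feat z.2.2, x⟫)]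
  refine ContinuousLinearMap.opNorm_le_bound _ (mul_nonneg zero_le_two (norm_nonneg G)) fun x => ?_
  rcases eq_or_ne (B x) 0 with h0 | h0
  · rw [h0, norm_zero]
    exact mul_nonneg (mul_nonneg zero_le_two (norm_nonneg G)) (norm_nonneg x)
  rcases eq_or_ne x 0 with rfl | hx
  · simp
  have hb : 0 < ‖B x‖ := norm_pos_iff.2 h0
  have hxp : 0 < ‖x‖ := norm_pos_iff.2 hx
  -- This y points along `B x` and has the norm of `x`, which turns the quadratic bound into ‖x‖ ‖B
  -- x‖ ≤ 2 ‖G‖ ‖x‖².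
  have h := hbil x ((‖x‖ / ‖B x‖) • B x)
  rw [real_inner_smul_left, real_inner_self_eq_norm_sq, norm_smul, norm_div, norm_norm, norm_norm,
    div_mul_cancel₀ _ hb.ne'] at h
  have h2 : ‖x‖ / ‖B x‖ * ‖B x‖ ^ 2 = ‖x‖ * ‖B x‖ := by field_simp
  rw [h2] at h
  change ‖B x‖ ≤ 2 * ‖G‖ * ‖x‖
  nlinarith

end TDProblem

/-! ### The proximal step -/

lemma prox_spec {d : ℕ} {X : Set (Vec d)} (hc : IsCompact X) (hne : X.Nonempty) {f : Vec d → ℝ}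
    (hf : Continuous f) (u : Vec d) :
    prox X f u ∈ X ∧ IsMinOn (fun q => f q + (1 / 2) * ‖q - u‖ ^ 2) X (prox X f u) :=
  Classical.epsilon_spec (p := fun p => p ∈ X ∧ IsMinOn (fun q => f q + (1 / 2) * ‖q - u‖ ^ 2) X p)
    (hc.exists_isMinOn hne (by fun_prop))

section InnerProduct

variable {E : Type*} [NormedAddCommGroup E] [InnerProductSpace ℝ E]

/-- Variational inequality for a proximal point. -/
lemma inner_le_of_isMinOn {X : Set E} {f : E → ℝ} (hX : Convex ℝ X) (hf : ConvexOn ℝ X f)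
    {u x p : E} (hx : x ∈ X) (hp : p ∈ X)
    (hmin : IsMinOn (fun q => f q + (1 / 2) * ‖q - u‖ ^ 2) X x) :
    f x + ⟪x - u, x - p⟫ ≤ f p := by
  by_contra! hlt
  set c := f x + ⟪x - u, x - p⟫ - f p with hc
  have hc0 : 0 < c := by linarith
  -- Compare the minimizer with the point at parameter `s` on the segment towards `p`, then divide
  -- by `s`.
  have key : ∀ s : ℝ, 0 < s → s ≤ 1 → c ≤ (1 / 2) * s * ‖p - x‖ ^ 2 := by
    intro s hs hs1
    have hmem : (1 - s) • x + s • p ∈ X := hX hx hp (by linarith) hs.le (by ring)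
    have h1 := hmin hmem
    have h2 := hf.2 hx hp (sub_nonneg.2 hs1) hs.le (by ring)
    simp only [Set.mem_ofPred_eq, smul_eq_mul] at h1 h2
    have h3 : (1 - s) • x + s • p - u = (x - u) + s • (p - x) := by module
    have h4 : ⟪x - u, x - p⟫ = -⟪x - u, p - x⟫ := by rw [← inner_neg_right, neg_sub]
    rw [h3, norm_add_sq_real, inner_smul_right, norm_smul, Real.norm_of_nonneg hs.le] at h1
    have h5 : s * c ≤ s * ((1 / 2) * s * ‖p - x‖ ^ 2) := by
      rw [hc, h4]; nlinarith
    exact le_of_mul_le_mul_left h5 hs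
  have hn : 0 ≤ ‖p - x‖ ^ 2 := sq_nonneg _
  -- With this `s` the bound is at most c/2, a contradiction; the added 1 keeps the denominator
  -- positive when p = x.
  have h := key (min 1 (c / (‖p - x‖ ^ 2 + 1))) (by positivity) (min_le_left _ _)
  have h' : min 1 (c / (‖p - x‖ ^ 2 + 1)) * (‖p - x‖ ^ 2 + 1) ≤ c :=
    (mul_le_mul_of_nonneg_right (min_le_right _ _) (by positivity)).trans_eq (by field_simp)
  have h0 : 0 ≤ min 1 (c / (‖p - x‖ ^ 2 + 1)) := by positivity
  nlinarith

/-- Three-point identity: it yields the telescoping distances and the spare term ‖x' - x‖² that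
absorbs the errors of a step. -/
lemma inner_sub_sub_eq (x x' u : E) :
    2 * ⟪x' - x, x' - u⟫ = ‖x' - x‖ ^ 2 + ‖x' - u‖ ^ 2 - ‖x - u‖ ^ 2 := by
  have h := norm_sub_sq_real (x' - u) (x' - x)
  rw [sub_sub_sub_cancel_left, real_inner_comm] at h
  linarith

/-- One step of the stochastic primal-dual method for `⟪K θ, y⟫ - ⟪y, G y⟫ / 2 + h θ`, where `η` and
`ε` are the errors of the two gradient estimates. -/
lemma saddle_step {K kt : E → E} {G : E →L[ℝ] E} {B LF D a : ℝ}
    (hB0 : 0 ≤ B) (hLF : 0 ≤ LF)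
    (hK : ∀ θ y, ⟪K θ, y⟫ = ⟪K 0, y⟫ + ⟪θ, kt y⟫) (hB : ∀ θ θ', ‖K θ - K θ'‖ ≤ B * ‖θ - θ'‖)
    (hGs : ∀ x y, ⟪x, G y⟫ = ⟪y, G x⟫) (hG0 : ∀ x, 0 ≤ ⟪x, G x⟫) (hG : ∀ x, ‖G x‖ ≤ LF * ‖x‖)
    (ha : 0 < a) {θ θ' u y y' v η ε : E} {hθ' hu : ℝ}
    (hθu : ‖θ' - u‖ ≤ D) (hyv : ‖y' - v‖ ≤ D)
    (h1 : a * hθ' + ⟪θ' - (θ - a • (kt y + η)), θ' - u⟫ ≤ a * hu)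
    (h2 : ⟪y' - (y + a • (K θ - G y + ε)), y' - v⟫ ≤ 0) :
    (⟪K θ', v⟫ - (1 / 2) * ⟪v, G v⟫ + hθ') - (⟪K u, y'⟫ - (1 / 2) * ⟪y', G y'⟫ + hu)
      ≤ (1 / (2 * a)) * (‖θ - u‖ ^ 2 - ‖θ' - u‖ ^ 2) + (1 / (2 * a)) * (‖y - v‖ ^ 2 - ‖y' - v‖ ^ 2)
        + a * (B ^ 2 * D ^ 2 + (LF + B) ^ 2 * D ^ 2 + ‖η‖ ^ 2 + ‖ε‖ ^ 2)
        + ⟪ε, y - v⟫ + ⟪η, u - θ⟫ := by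
  have hD : 0 ≤ D := (norm_nonneg _).trans hθu
  -- the two proximal inequalities, solved for the gradient terms
  have e1 : hθ' - hu + ⟪kt y, θ' - u⟫ + ⟪η, θ' - u⟫
      ≤ (1 / (2 * a)) * (‖θ - u‖ ^ 2 - ‖θ' - u‖ ^ 2) - (1 / (2 * a)) * ‖θ' - θ‖ ^ 2 := by
    have h3 : θ' - (θ - a • (kt y + η)) = (θ' - θ) + a • (kt y + η) := by abel
    rw [h3, inner_add_left, real_inner_smul_left, inner_add_left] at h1
    have h4 := inner_sub_sub_eq θ θ' u
    have h5 : a * (hθ' - hu + ⟪kt y, θ' - u⟫ + ⟪η, θ' - u⟫)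
        ≤ a * ((1 / (2 * a)) * (‖θ - u‖ ^ 2 - ‖θ' - u‖ ^ 2) - (1 / (2 * a)) * ‖θ' - θ‖ ^ 2) := by
      field_simp
      linarith
    exact le_of_mul_le_mul_left h5 ha
  have e2 : -⟪K θ, y' - v⟫ + ⟪G y, y' - v⟫ - ⟪ε, y' - v⟫
      ≤ (1 / (2 * a)) * (‖y - v‖ ^ 2 - ‖y' - v‖ ^ 2) - (1 / (2 * a)) * ‖y' - y‖ ^ 2 := by
    have h3 : y' - (y + a • (K θ - G y + ε)) = (y' - y) - a • (K θ - G y + ε) := by abel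
    rw [h3, inner_sub_left, real_inner_smul_left, inner_add_left, inner_sub_left (K θ)] at h2
    have h4 := inner_sub_sub_eq y y' v
    have h5 : a * (-⟪K θ, y' - v⟫ + ⟪G y, y' - v⟫ - ⟪ε, y' - v⟫)
        ≤ a * ((1 / (2 * a)) * (‖y - v‖ ^ 2 - ‖y' - v‖ ^ 2) - (1 / (2 * a)) * ‖y' - y‖ ^ 2) := by
      field_simp
      linarith
    exact le_of_mul_le_mul_left h5 ha
  -- errors of the extrapolation from the old to the new iterate
  have b1 : ⟪K θ' - K θ, v - y'⟫ ≤ B * D * ‖θ' - θ‖ := by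
    refine (real_inner_le_norm _ _).trans ?_
    rw [norm_sub_rev v]
    calc ‖K θ' - K θ‖ * ‖y' - v‖ ≤ (B * ‖θ' - θ‖) * D :=
          mul_le_mul (hB _ _) hyv (norm_nonneg _) (by positivity)
      _ = _ := by ring
  have b2 : ⟪K θ' - K u, y' - y⟫ ≤ B * D * ‖y' - y‖ := by
    refine (real_inner_le_norm _ _).trans ?_
    exact mul_le_mul_of_nonneg_right ((hB _ _).trans (mul_le_mul_of_nonneg_left hθu hB0))
      (norm_nonneg _)
  have b3 : ⟪G (y' - y), y' - v⟫ ≤ LF * D * ‖y' - y‖ := by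
    refine (real_inner_le_norm _ _).trans ?_
    calc ‖G (y' - y)‖ * ‖y' - v‖ ≤ (LF * ‖y' - y‖) * D :=
          mul_le_mul (hG _) hyv (norm_nonneg _) (by positivity)
      _ = _ := by ring
  have b4 : ⟪ε, y' - y⟫ ≤ ‖ε‖ * ‖y' - y‖ := real_inner_le_norm _ _
  have b5 : -⟪η, θ' - θ⟫ ≤ ‖η‖ * ‖θ' - θ‖ := by
    rw [← inner_neg_right, ← norm_neg (θ' - θ)]
    exact real_inner_le_norm _ _
  -- All errors are linear in the increment `r`, so the spare -r²/(2a) from the three-point identity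
  -- absorbs them at a cost of order `a`.
  have young : ∀ p q r : ℝ, p * r + q * r - (1 / (2 * a)) * r ^ 2 ≤ a * (p ^ 2 + q ^ 2) := by
    intro p q r
    have h3 : a * (p ^ 2 + q ^ 2) - (p * r + q * r - (1 / (2 * a)) * r ^ 2)
        = (a / 2) * (p - q) ^ 2 + (1 / (2 * a)) * (a * (p + q) - r) ^ 2 := by
      field_simp
      ring
    have h4 : 0 ≤ (a / 2) * (p - q) ^ 2 + (1 / (2 * a)) * (a * (p + q) - r) ^ 2 := by positivity
    linarith
  have y1 := young (B * D) ‖η‖ ‖θ' - θ‖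
  have y2 := young ((LF + B) * D) ‖ε‖ ‖y' - y‖
  -- convexity of the quadratic term
  have c1 : (1 / 2) * ⟪y', G y'⟫ - (1 / 2) * ⟪v, G v⟫ ≤ ⟪G y', y' - v⟫ := by
    have h3 := hG0 (y' - v)
    have h4 := hGs v y'
    simp only [map_sub, inner_sub_left, inner_sub_right] at h3
    rw [inner_sub_right, real_inner_comm y', real_inner_comm v]
    linarith
  -- The method uses gradients at the old iterate while the gap is taken at the new one; the two
  -- K-differences on the right are the price.
  have d1 : ⟪K θ', v⟫ - ⟪K u, y'⟫
      = ⟪K θ' - K θ, v - y'⟫ - ⟪K θ, y' - v⟫ + ⟪K θ' - K u, y' - y⟫ + ⟪kt y, θ' - u⟫ := by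
    have h3 : ⟪kt y, θ' - u⟫ = ⟪K θ' - K u, y⟫ := by
      rw [inner_sub_left, hK θ', hK u, real_inner_comm, inner_sub_left]; ring
    rw [h3]
    simp only [inner_sub_left, inner_sub_right]
    ring
  have d2 : ⟪G y', y' - v⟫ = ⟪G (y' - y), y' - v⟫ + ⟪G y, y' - v⟫ := by
    rw [map_sub, inner_sub_left]; ring
  -- The new iterate depends on the current noise, the old one does not; only the pairing with the
  -- old iterate can be centred.
  have d3 : ⟪ε, y' - v⟫ = ⟪ε, y' - y⟫ + ⟪ε, y - v⟫ := by
    rw [← inner_add_right]; congr 1; abel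
  have d4 : ⟪η, θ' - u⟫ = ⟪η, θ' - θ⟫ - ⟪η, u - θ⟫ := by
    rw [← inner_sub_right]; congr 1; abel
  linarith

/-- Summation by parts for non-increasing step sizes. -/
lemma sum_telescope_le {α e : ℕ → ℝ} {M : ℝ} {n : ℕ} (hα : ∀ t ≤ n, 0 < α t)
    (hanti : ∀ t < n, α (t + 1) ≤ α t) (he : ∀ t, 0 ≤ e t) (heM : ∀ t ≤ n, e t ≤ M) :
    ∑ t ∈ Finset.range (n + 1), (1 / (2 * α t)) * (e t - e (t + 1)) ≤ M / (2 * α n) := by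
  -- The induction needs the term -e (m + 1) kept: M - e (m + 1) ≥ 0 lets the denominator pass to
  -- the next, smaller step size.
  have h : ∀ m ≤ n, ∑ t ∈ Finset.range (m + 1), (1 / (2 * α t)) * (e t - e (t + 1))
      ≤ (M - e (m + 1)) / (2 * α m) := by
    intro m
    induction m with
    | zero =>
      intro _
      rw [Finset.sum_range_one, div_mul_eq_mul_div, one_mul]
      have := hα 0 (Nat.zero_le _)
      gcongr
      exact heM 0 (Nat.zero_le _)
    | succ m ih =>
      intro hm
      rw [Finset.sum_range_succ]
      have h0 := hα m (by omega)
      have h1 := hα (m + 1) hm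
      have h2 : (M - e (m + 1)) / (2 * α m) ≤ (M - e (m + 1)) / (2 * α (m + 1)) := by
        have := heM (m + 1) hm
        have := hanti m (by omega)
        gcongr
      refine (add_le_add_left ((ih (by omega)).trans h2) _).trans_eq ?_
      field_simp
      ring
  refine (h n le_rfl).trans ?_
  have := hα n le_rfl
  have := he (n + 1)
  gcongr
  linarith

end InnerProduct

/-- Telescopes through 1/√(n+1) ≤ 2(√(n+1) - √n). -/
lemma sum_inv_sqrt_le (n : ℕ) : ∑ t ∈ Finset.range n, 1 / √((t : ℝ) + 1) ≤ 2 * √n := by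
  induction n with
  | zero => simp
  | succ n ih =>
    rw [Finset.sum_range_succ]
    have h1 : 0 < √((n : ℝ) + 1) := Real.sqrt_pos.2 (by positivity)
    have h2 : √(n : ℝ) ^ 2 = n := Real.sq_sqrt (Nat.cast_nonneg n)
    have h3 : √((n : ℝ) + 1) ^ 2 = n + 1 := Real.sq_sqrt (by positivity)
    have h4 : 1 / √((n : ℝ) + 1) ≤ 2 * (√((n : ℝ) + 1) - √n) := by
      rw [div_le_iff₀ h1]
      nlinarith [sq_nonneg (√((n : ℝ) + 1) - √n)]
    push_cast
    linarith

/-! ### Sums of conditionally centred terms -/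

section Noise

variable {Ω T E : Type*} [MeasurableSpace Ω] {μ : Measure Ω} [IsProbabilityMeasure μ] [Fintype T]
  [Nonempty T] [NormedAddCommGroup E] [InnerProductSpace ℝ E] {Z : ℕ → Ω → T} {w : T → ℝ}
  {ν : ℕ → T → (ℕ → T) → E} {c : ℝ}

omit [Fintype T] [Nonempty T] in
lemma dependsOn_current {E : Type*} {t : ℕ} {f : T → (ℕ → T) → E}
    (hf : ∀ z, DependsOn (f z) (Set.Iio t)) :
    DependsOn (fun zs => f (zs t) zs) (Set.Iio (t + 1)) := by
  intro zs zs' h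
  have h1 : zs t = zs' t := h t (Set.mem_Iio.2 t.lt_succ_self)
  change f (zs t) zs = f (zs' t) zs'
  rw [h1]
  exact hf _ fun i hi => h i ((Set.mem_Iio.1 hi).trans t.lt_succ_self)

omit [Fintype T] [Nonempty T] [InnerProductSpace ℝ E] in
lemma dependsOn_sum_current (hdep : ∀ t z, DependsOn (ν t z) (Set.Iio t)) (n : ℕ) :
    DependsOn (fun zs => ∑ t ∈ Finset.range n, ν t (zs t) zs) (Set.Iio n) := by
  intro zs zs' h
  refine Finset.sum_congr rfl fun t ht => ?_
  have ht' := Finset.mem_range.1 ht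
  exact dependsOn_current (hdep t) fun i hi =>
    h i (lt_of_lt_of_le (Set.mem_Iio.1 hi) (Nat.succ_le_of_lt ht'))

omit [InnerProductSpace ℝ E] in
lemma integral_norm_sq_current_le (hZ : ∀ t z, MeasurableSet (Z t ⁻¹' {z}))
    (hw : ∀ t z, μ.real (Z t ⁻¹' {z}) = w z) (hind : iIndepFun (m := fun _ => ⊤) Z μ)
    (hdep : ∀ t z, DependsOn (ν t z) (Set.Iio t)) {t : ℕ}
    (hvar : ∀ zs, ∑ z, w z * ‖ν t z zs‖ ^ 2 ≤ c) :
    ∫ ω, ‖ν t (Z t ω) fun i => Z i ω‖ ^ 2 ∂μ ≤ c := by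
  have hd : ∀ z, DependsOn (fun zs => ‖ν t z zs‖ ^ 2) (Set.Iio t) := fun z zs zs' h => by
    simp only [hdep t z h]
  have hd' : DependsOn (fun zs => ∑ z, w z • ‖ν t z zs‖ ^ 2) (Set.Iio t) := fun zs zs' h =>
    Finset.sum_congr rfl fun z _ => congrArg (w z • ·) (hd z h)
  rw [integral_sample hZ hw hind hd]
  refine (integral_mono (integrable_of_dependsOn hZ hd') (integrable_const c)
    fun ω => hvar _).trans_eq ?_
  simp

lemma integral_inner_current (hZ : ∀ t z, MeasurableSet (Z t ⁻¹' {z}))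
    (hw : ∀ t z, μ.real (Z t ⁻¹' {z}) = w z) (hind : iIndepFun (m := fun _ => ⊤) Z μ)
    (hdep : ∀ t z, DependsOn (ν t z) (Set.Iio t)) {t : ℕ}
    (hzero : ∀ zs, ∑ z, w z • ν t z zs = 0) {W : (ℕ → T) → E} (hW : DependsOn W (Set.Iio t)) :
    ∫ ω, ⟪ν t (Z t ω) fun i => Z i ω, W fun i => Z i ω⟫ ∂μ = 0 := by
  have hd : ∀ z, DependsOn (fun zs => ⟪ν t z zs, W zs⟫) (Set.Iio t) := fun z zs zs' h => by
    simp only [hdep t z h, hW h]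
  rw [integral_sample hZ hw hind hd]
  refine (integral_congr_ae (g := fun _ => (0 : ℝ)) (.of_forall fun ω => ?_)).trans (integral_zero _ _)
  change ∑ z, w z * ⟪ν t z fun i => Z i ω, W fun i => Z i ω⟫ = 0
  simp_rw [← real_inner_smul_left]
  rw [← sum_inner, hzero, inner_zero_left]

/-- Conditionally centred terms are orthogonal, so their variances add up. -/
lemma integral_norm_sq_sum_current_le (hZ : ∀ t z, MeasurableSet (Z t ⁻¹' {z}))
    (hw : ∀ t z, μ.real (Z t ⁻¹' {z}) = w z) (hind : iIndepFun (m := fun _ => ⊤) Z μ)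
    (hdep : ∀ t z, DependsOn (ν t z) (Set.Iio t)) (hzero : ∀ t zs, ∑ z, w z • ν t z zs = 0)
    (hvar : ∀ t zs, ∑ z, w z * ‖ν t z zs‖ ^ 2 ≤ c) (n : ℕ) :
    ∫ ω, ‖∑ t ∈ Finset.range n, ν t (Z t ω) fun i => Z i ω‖ ^ 2 ∂μ ≤ n * c := by
  induction n with
  | zero => simp
  | succ n ih =>
    have hs := dependsOn_sum_current hdep n
    have hn := dependsOn_current (hdep n)
    have i1 : Integrable
        (fun ω => ‖∑ t ∈ Finset.range n, ν t (Z t ω) fun i => Z i ω‖ ^ 2) μ :=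
      integrable_of_dependsOn hZ (t := n)
        (f := fun zs => ‖∑ t ∈ Finset.range n, ν t (zs t) zs‖ ^ 2)
        fun zs zs' h => congrArg (‖·‖ ^ 2) (hs h)
    have i2 : Integrable (fun ω => ‖ν n (Z n ω) fun i => Z i ω‖ ^ 2) μ :=
      integrable_of_dependsOn hZ (t := n + 1) (f := fun zs => ‖ν n (zs n) zs‖ ^ 2)
        fun zs zs' h => congrArg (‖·‖ ^ 2) (hn h)
    have i3 : Integrable (fun ω => ⟪ν n (Z n ω) fun i => Z i ω,
        ∑ t ∈ Finset.range n, ν t (Z t ω) fun i => Z i ω⟫) μ :=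
      integrable_of_dependsOn hZ (t := n + 1)
        (f := fun zs => ⟪ν n (zs n) zs, ∑ t ∈ Finset.range n, ν t (zs t) zs⟫)
        fun zs zs' h => by
          have e1 : ν n (zs n) zs = ν n (zs' n) zs' := hn h
          have e2 : ∑ t ∈ Finset.range n, ν t (zs t) zs = ∑ t ∈ Finset.range n, ν t (zs' t) zs' :=
            hs fun i hi => h i ((Set.mem_Iio.1 hi).trans n.lt_succ_self)
          simp only [e1, e2]
    -- The sum of the earlier terms is a function of the past, so the cross term vanishes in mean.
    have i4 := integral_inner_current hZ hw hind hdep (hzero n) hs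
    have i5 := integral_norm_sq_current_le hZ hw hind hdep (hvar n)
    simp_rw [Finset.sum_range_succ, norm_add_sq_real, real_inner_comm (ν n _ _)]
    have i13 : Integrable (fun ω => ‖∑ t ∈ Finset.range n, ν t (Z t ω) fun i => Z i ω‖ ^ 2
        + 2 * ⟪ν n (Z n ω) fun i => Z i ω, ∑ t ∈ Finset.range n, ν t (Z t ω) fun i => Z i ω⟫) μ :=
      i1.add (i3.const_mul 2)
    rw [integral_add i13 i2, integral_add i1 (i3.const_mul 2),
      integral_const_mul, i4]
    push_cast
    linarith

end Noise

/-! ### Iterates of the two algorithms -/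

lemma sum_Icc_one_eq {E : Type*} [AddCommMonoid E] (f : ℕ → E) (n : ℕ) :
    ∑ i ∈ Finset.Icc 1 n, f i = ∑ t ∈ Finset.range n, f (t + 1) := by
  induction n with
  | zero => simp
  | succ n ih => rw [Finset.sum_Icc_succ_top (by omega), ih, Finset.sum_range_succ]

lemma ConvexOn.natCast_mul_map_mean_le {E : Type*} [AddCommGroup E] [Module ℝ E] {f : E → ℝ}
    (hf : ConvexOn ℝ Set.univ f) {n : ℕ} (hn : 0 < n) (x : ℕ → E) :
    n * f ((n : ℝ)⁻¹ • ∑ t ∈ Finset.range n, x t) ≤ ∑ t ∈ Finset.range n, f (x t) := by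
  have hn' : (0 : ℝ) < n := Nat.cast_pos.2 hn
  have h := hf.map_sum_le (t := Finset.range n) (w := fun _ => (n : ℝ)⁻¹) (p := x)
    (fun _ _ => by positivity) (by simp [hn'.ne']) (fun _ _ => Set.mem_univ _)
  rw [← Finset.smul_sum, ← Finset.smul_sum, smul_eq_mul] at h
  calc n * f ((n : ℝ)⁻¹ • ∑ t ∈ Finset.range n, x t)
      ≤ n * ((n : ℝ)⁻¹ * ∑ t ∈ Finset.range n, f (x t)) := by gcongr
    _ = _ := by field_simp

namespace TDProblem

variable {S A : Type*} [Fintype S] [Fintype A] {d : ℕ} (Q : TDProblem S A d)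

lemma continuous_h : Continuous Q.h := by
  rw [← continuousOn_univ]
  exact Q.h_convex.continuousOn isOpen_univ

/-- The iterate at time t reads only the samples before t, which is what makes it independent of the
sample at time t. -/
lemma iterates_congr (alg : GradTD) (α : ℕ → ℝ) (θ₀ y₀ : Vec d) {zs zs' : ℕ → S × A × S} {t : ℕ}
    (h : ∀ i < t, zs i = zs' i) :
    Q.iterates alg α θ₀ y₀ zs t = Q.iterates alg α θ₀ y₀ zs' t := by
  induction t with
  | zero => rfl
  | succ t ih =>
    have h1 := ih fun i hi => h i (hi.trans t.lt_succ_self)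
    simp only [iterates, h1, h t t.lt_succ_self]

lemma average_congr (alg : GradTD) (α : ℕ → ℝ) (θ₀ y₀ : Vec d) {zs zs' : ℕ → S × A × S} {n : ℕ}
    (h : ∀ i < n, zs i = zs' i) :
    Q.average alg α θ₀ y₀ zs n = Q.average alg α θ₀ y₀ zs' n := by
  simp only [average]
  congr 1
  refine Finset.sum_congr rfl fun i hi => Q.iterates_congr alg α θ₀ y₀ fun j hj => h j ?_
  have := (Finset.mem_Icc.1 hi).2
  omega

lemma iterates_mem {alg : GradTD} {α : ℕ → ℝ} {θ₀ y₀ : Vec d} (hθ : θ₀ ∈ Q.X) (hy : y₀ ∈ Q.Y)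
    (zs : ℕ → S × A × S) (t : ℕ) :
    (Q.iterates alg α θ₀ y₀ zs t).1 ∈ Q.X ∧ (Q.iterates alg α θ₀ y₀ zs t).2 ∈ Q.Y := by
  cases t with
  | zero => exact ⟨hθ, hy⟩
  | succ t =>
    exact ⟨(prox_spec Q.X_compact Q.X_nonempty (continuous_const.mul Q.continuous_h) _).1,
      (prox_spec Q.Y_compact Q.Y_nonempty continuous_const _).1⟩

lemma average_fst (alg : GradTD) (α : ℕ → ℝ) (θ₀ y₀ : Vec d) (zs : ℕ → S × A × S) (n : ℕ) :
    (Q.average alg α θ₀ y₀ zs n).1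
      = (n : ℝ)⁻¹ • ∑ t ∈ Finset.range n, (Q.iterates alg α θ₀ y₀ zs (t + 1)).1 := by
  rw [average, sum_Icc_one_eq, Prod.smul_fst, Prod.fst_sum]

lemma average_snd (alg : GradTD) (α : ℕ → ℝ) (θ₀ y₀ : Vec d) (zs : ℕ → S × A × S) (n : ℕ) :
    (Q.average alg α θ₀ y₀ zs n).2
      = (n : ℝ)⁻¹ • ∑ t ∈ Finset.range n, (Q.iterates alg α θ₀ y₀ zs (t + 1)).2 := by
  rw [average, sum_Icc_one_eq, Prod.smul_snd, Prod.snd_sum]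

lemma average_fst_mem {alg : GradTD} {α : ℕ → ℝ} {θ₀ y₀ : Vec d} (hθ : θ₀ ∈ Q.X) (hy : y₀ ∈ Q.Y)
    (zs : ℕ → S × A × S) {n : ℕ} (hn : 0 < n) : (Q.average alg α θ₀ y₀ zs n).1 ∈ Q.X := by
  have hn' : (0 : ℝ) < n := Nat.cast_pos.2 hn
  rw [average_fst, Finset.smul_sum]
  exact Q.X_convex.sum_mem (fun _ _ => by positivity) (by simp [hn'.ne'])
    fun t _ => (Q.iterates_mem hθ hy zs (t + 1)).1

/-! ### Convexity of the saddle function, gradient noise and the pathwise gap bound -/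

variable [DecidableEq S]

lemma convexOn_saddle (alg : GradTD) (y : Vec d) :
    ConvexOn ℝ Set.univ fun θ => Q.saddle alg θ y := by
  refine ⟨convex_univ, fun θ _ θ' _ a b ha hb hab => ?_⟩
  have h := Q.h_convex.2 (Set.mem_univ θ) (Set.mem_univ θ') ha hb hab
  simp only [saddle, smul_eq_mul] at h ⊢
  rw [Q.inner_K (a • θ + b • θ'), Q.inner_K θ, Q.inner_K θ', inner_add_left, real_inner_smul_left,
    real_inner_smul_left]
  obtain rfl : b = 1 - a := by linarith
  linarith

lemma convexOn_neg_saddle (alg : GradTD) (θ : Vec d) :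
    ConvexOn ℝ Set.univ fun y => -Q.saddle alg θ y := by
  refine ⟨convex_univ, fun x _ y _ a b ha hb hab => ?_⟩
  have h := mul_nonneg (mul_nonneg ha hb) (Q.inner_dualHess_nonneg alg (x - y))
  have hc := Q.inner_dualHess_comm alg x y
  obtain rfl : b = 1 - a := by linarith
  simp only [saddle_eq, smul_eq_mul, map_add, map_sub, map_smul, inner_add_left, inner_add_right,
    inner_sub_left, inner_sub_right, real_inner_smul_left, inner_smul_right] at h ⊢
  rw [hc] at h ⊢
  linarith

/-- Error of the estimate of the gradient in the dual variable at `x = (θ, y)`. -/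
noncomputable def dualNoise (alg : GradTD) (z : S × A × S) (x : Vec d × Vec d) : Vec d :=
  (Q.oracleK z x.1 - Q.oracleF alg z x.2) - (Q.K x.1 - Q.dualHess alg x.2)

omit [DecidableEq S] in
/-- Error of the estimate of the gradient of the bilinear term in the primal variable. -/
noncomputable def primalNoise (z : S × A × S) (x : Vec d × Vec d) : Vec d :=
  Q.oracleKT z x.2 - Q.expect fun z' => Q.oracleKT z' x.2

lemma expect_dualNoise (alg : GradTD) (x : Vec d × Vec d) :
    ∑ z, Q.weight z • Q.dualNoise alg z x = 0 := by
  change Q.expect (fun z => Q.dualNoise alg z x) = 0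
  simp only [dualNoise]
  rw [expect_sub, expect_sub, expect_const, expect_oracleK, expect_oracleF, sub_self]

omit [DecidableEq S] in
lemma expect_primalNoise (x : Vec d × Vec d) : ∑ z, Q.weight z • Q.primalNoise z x = 0 := by
  change Q.expect (fun z => Q.primalNoise z x) = 0
  simp only [primalNoise]
  rw [expect_sub, expect_const, sub_self]

variable {Q}

/-- Both dual oracles use the same sample and may be correlated, so the variances are combined by ‖a
- b‖² ≤ 2‖a‖² + 2‖b‖²; hence the factor 2. -/
lemma VarianceBound.dualNoise_le {alg : GradTD} {σF σKθ σKy : ℝ}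
    (hV : Q.VarianceBound alg σF σKθ σKy) {x : Vec d × Vec d} (h1 : x.1 ∈ Q.X) (h2 : x.2 ∈ Q.Y) :
    ∑ z, Q.weight z * ‖Q.dualNoise alg z x‖ ^ 2 ≤ 2 * (σF ^ 2 + σKθ ^ 2) := by
  have hF := hV.boundF _ h2
  have hK := hV.boundK _ h1
  rw [(Q.hasGradientAt_Fstar alg x.2).gradient] at hF
  have h : Q.expect (fun z => ‖Q.dualNoise alg z x‖ ^ 2) ≤
      2 * Q.expect (fun z => ‖Q.oracleF alg z x.2 - Q.dualHess alg x.2‖ ^ 2)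
        + 2 * Q.expect (fun z => ‖Q.oracleK z x.1 - Q.K x.1‖ ^ 2) := by
    rw [← expect_mul_left, ← expect_mul_left, ← expect_add]
    refine Q.expect_mono fun z => ?_
    have e : Q.dualNoise alg z x
        = (Q.oracleK z x.1 - Q.K x.1) - (Q.oracleF alg z x.2 - Q.dualHess alg x.2) := by
      rw [dualNoise]; abel
    rw [e]
    nlinarith [norm_sub_le (Q.oracleK z x.1 - Q.K x.1) (Q.oracleF alg z x.2 - Q.dualHess alg x.2),
      norm_nonneg ((Q.oracleK z x.1 - Q.K x.1) - (Q.oracleF alg z x.2 - Q.dualHess alg x.2)),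
      sq_nonneg (‖Q.oracleK z x.1 - Q.K x.1‖ - ‖Q.oracleF alg z x.2 - Q.dualHess alg x.2‖)]
  change Q.expect (fun z => ‖Q.dualNoise alg z x‖ ^ 2) ≤ _
  linarith

lemma VarianceBound.primalNoise_le {alg : GradTD} {σF σKθ σKy : ℝ}
    (hV : Q.VarianceBound alg σF σKθ σKy) {x : Vec d × Vec d} (h1 : x.1 ∈ Q.X) (h2 : x.2 ∈ Q.Y) :
    ∑ z, Q.weight z * ‖Q.primalNoise z x‖ ^ 2 ≤ σKy ^ 2 := by
  have h := hV.boundKT _ h1 _ h2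
  rwa [(Q.hasGradientAt_inner_K x.1 x.2).gradient] at h

variable (Q)

lemma gap_le_of_forall {alg : GradTD} {θ y' : Vec d} {c : ℝ}
    (h : ∀ u ∈ Q.X, ∀ v ∈ Q.Y, Q.saddle alg θ v - Q.saddle alg u y' ≤ c) :
    Q.gap alg θ y' ≤ c := by
  have := Q.X_nonempty.to_subtype
  have := Q.Y_nonempty.to_subtype
  rw [gap, sub_le_iff_le_add]
  refine ciSup_le fun v => ?_
  rw [← sub_le_iff_le_add']
  refine le_ciInf fun u => ?_
  linarith [h u u.2 v v.2]

/-- Pathwise bound of the duality gap of the averaged iterates. -/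
lemma gap_average_le {alg : GradTD} {α : ℕ → ℝ} {θ₀ y₀ : Vec d} (hθ : θ₀ ∈ Q.X) (hy : y₀ ∈ Q.Y)
    {D : ℝ} (hX : Metric.diam Q.X ≤ D) (hY : Metric.diam Q.Y ≤ D) {n : ℕ}
    (hα : ∀ t ≤ n, 0 < α t) (hanti : ∀ t < n, α (t + 1) ≤ α t) (zs : ℕ → S × A × S)
    (x : ℕ → Vec d × Vec d) (hx : x = Q.iterates alg α θ₀ y₀ zs) :
    ((n + 1 : ℕ) : ℝ) * Q.gap alg (Q.average alg α θ₀ y₀ zs (n + 1)).1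
        (Q.average alg α θ₀ y₀ zs (n + 1)).2
      ≤ D ^ 2 / α n
        + ∑ t ∈ Finset.range (n + 1), α t * (Q.normTD ^ 2 * D ^ 2
            + (Q.LFstar alg + Q.normTD) ^ 2 * D ^ 2
            + ‖Q.primalNoise (zs t) (x t)‖ ^ 2 + ‖Q.dualNoise alg (zs t) (x t)‖ ^ 2)
        + ∑ t ∈ Finset.range (n + 1), ⟪Q.dualNoise alg (zs t) (x t), (x t).2 - y₀⟫
        + ∑ t ∈ Finset.range (n + 1), ⟪Q.primalNoise (zs t) (x t), θ₀ - (x t).1⟫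
        + D * ‖∑ t ∈ Finset.range (n + 1), Q.dualNoise alg (zs t) (x t)‖
        + D * ‖∑ t ∈ Finset.range (n + 1), Q.primalNoise (zs t) (x t)‖ := by
  have hn : (0 : ℝ) < ((n + 1 : ℕ) : ℝ) := by positivity
  rw [← le_div_iff₀' hn]
  refine Q.gap_le_of_forall fun u hu v hv => ?_
  rw [le_div_iff₀' hn, mul_sub, average_fst, average_snd, ← hx]
  have j1 := (Q.convexOn_saddle alg v).natCast_mul_map_mean_le (n := n + 1) (by omega) fun t => (x (t + 1)).1
  have j2 := (Q.convexOn_neg_saddle alg u).natCast_mul_map_mean_le (n := n + 1) (by omega) fun t => (x (t + 1)).2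
  rw [Finset.sum_neg_distrib, mul_neg, neg_le_neg_iff] at j2
  refine (sub_le_sub j1 j2).trans ?_
  rw [← Finset.sum_sub_distrib]
  have hmem : ∀ t, (x t).1 ∈ Q.X ∧ (x t).2 ∈ Q.Y := fun t => hx ▸ Q.iterates_mem hθ hy zs t
  have dX : ∀ {p q}, p ∈ Q.X → q ∈ Q.X → ‖p - q‖ ≤ D := fun hp hq => by
    rw [← dist_eq_norm]
    exact (Metric.dist_le_diam_of_mem Q.X_compact.isBounded hp hq).trans hX
  have dY : ∀ {p q}, p ∈ Q.Y → q ∈ Q.Y → ‖p - q‖ ≤ D := fun hp hq => by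
    rw [← dist_eq_norm]
    exact (Metric.dist_le_diam_of_mem Q.Y_compact.isBounded hp hq).trans hY
  -- The noise pairings are split at the deterministic points `y₀` and `θ₀`: one part is free of the
  -- comparison point, the other has a factor that does not depend on t.
  have hstep : ∀ t ∈ Finset.range (n + 1),
      Q.saddle alg (x (t + 1)).1 v - Q.saddle alg u (x (t + 1)).2
      ≤ (1 / (2 * α t)) * (‖(x t).1 - u‖ ^ 2 - ‖(x (t + 1)).1 - u‖ ^ 2)
        + (1 / (2 * α t)) * (‖(x t).2 - v‖ ^ 2 - ‖(x (t + 1)).2 - v‖ ^ 2)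
        + α t * (Q.normTD ^ 2 * D ^ 2 + (Q.LFstar alg + Q.normTD) ^ 2 * D ^ 2
            + ‖Q.primalNoise (zs t) (x t)‖ ^ 2 + ‖Q.dualNoise alg (zs t) (x t)‖ ^ 2)
        + (⟪Q.dualNoise alg (zs t) (x t), (x t).2 - y₀⟫
          + ⟪Q.dualNoise alg (zs t) (x t), y₀ - v⟫)
        + (⟪Q.primalNoise (zs t) (x t), θ₀ - (x t).1⟫
          + ⟪Q.primalNoise (zs t) (x t), u - θ₀⟫) := by
    intro t ht
    have ha := hα t (Nat.lt_succ_iff.1 (Finset.mem_range.1 ht))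
    have hs1 : (x (t + 1)).1 = prox Q.X (fun p => α t * Q.h p)
        ((x t).1 - α t • Q.oracleKT (zs t) (x t).2) := by
      rw [hx]; rfl
    have hs2 : (x (t + 1)).2 = prox Q.Y (fun _ => 0)
        ((x t).2 + α t • (Q.oracleK (zs t) (x t).1 - Q.oracleF alg (zs t) (x t).2)) := by
      rw [hx]; rfl
    have hconv : ConvexOn ℝ Q.X fun p => α t * Q.h p :=
      (Q.h_convex.subset (Set.subset_univ _) Q.X_convex).smul ha.le
    have p1 := prox_spec Q.X_compact Q.X_nonempty
      (f := fun p => α t * Q.h p) (continuous_const.mul Q.continuous_h)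
      ((x t).1 - α t • Q.oracleKT (zs t) (x t).2)
    have p2 := prox_spec Q.Y_compact Q.Y_nonempty (f := fun _ => 0) continuous_const
      ((x t).2 + α t • (Q.oracleK (zs t) (x t).1 - Q.oracleF alg (zs t) (x t).2))
    have q1 := inner_le_of_isMinOn Q.X_convex hconv p1.1 hu p1.2
    have q2 := inner_le_of_isMinOn Q.Y_convex (convexOn_const 0 Q.Y_convex) p2.1 hv p2.2
    rw [← hs1] at q1
    rw [← hs2, zero_add] at q2
    have e1 : Q.oracleKT (zs t) (x t).2
        = (Q.expect fun z => Q.oracleKT z (x t).2) + Q.primalNoise (zs t) (x t) := by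
      rw [primalNoise]; abel
    have e2 : Q.oracleK (zs t) (x t).1 - Q.oracleF alg (zs t) (x t).2
        = Q.K (x t).1 - Q.dualHess alg (x t).2 + Q.dualNoise alg (zs t) (x t) := by
      rw [dualNoise]; abel
    rw [e1] at q1
    rw [e2] at q2
    have := saddle_step (K := Q.K) (kt := fun y => Q.expect fun z => Q.oracleKT z y)
      (norm_nonneg _) (Q.LFstar_nonneg alg) Q.inner_K Q.norm_K_sub_le (Q.inner_dualHess_comm alg)
      (Q.inner_dualHess_nonneg alg) (Q.norm_dualHess_le alg) ha
      (dX (hmem (t + 1)).1 hu) (dY (hmem (t + 1)).2 hv) q1 q2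
    rw [← saddle_eq, ← saddle_eq] at this
    rw [← inner_add_right, ← inner_add_right, sub_add_sub_cancel, add_comm (θ₀ - (x t).1),
      sub_add_sub_cancel]
    exact this
  refine (Finset.sum_le_sum hstep).trans ?_
  simp only [Finset.sum_add_distrib]
  have t1 := sum_telescope_le hα hanti (e := fun t => ‖(x t).1 - u‖ ^ 2) (M := D ^ 2)
    (fun _ => sq_nonneg _) fun t _ => pow_le_pow_left₀ (norm_nonneg _) (dX (hmem t).1 hu) 2
  have t2 := sum_telescope_le hα hanti (e := fun t => ‖(x t).2 - v‖ ^ 2) (M := D ^ 2)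
    (fun _ => sq_nonneg _) fun t _ => pow_le_pow_left₀ (norm_nonneg _) (dY (hmem t).2 hv) 2
  have t3 : D ^ 2 / (2 * α n) + D ^ 2 / (2 * α n) = D ^ 2 / α n := by ring
  have s1 : ∑ t ∈ Finset.range (n + 1), ⟪Q.dualNoise alg (zs t) (x t), y₀ - v⟫
      ≤ D * ‖∑ t ∈ Finset.range (n + 1), Q.dualNoise alg (zs t) (x t)‖ := by
    rw [← sum_inner, mul_comm]
    exact (real_inner_le_norm _ _).trans (mul_le_mul_of_nonneg_left (dY hy hv) (norm_nonneg _))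
  have s2 : ∑ t ∈ Finset.range (n + 1), ⟪Q.primalNoise (zs t) (x t), u - θ₀⟫
      ≤ D * ‖∑ t ∈ Finset.range (n + 1), Q.primalNoise (zs t) (x t)‖ := by
    rw [← sum_inner, mul_comm]
    exact (real_inner_le_norm _ _).trans (mul_le_mul_of_nonneg_left (dX hu hθ) (norm_nonneg _))
  linarith

end TDProblem

/-! ### The rate of convergence -/

namespace TDProblem

variable {S A : Type*} [Fintype S] [DecidableEq S] [Fintype A] {d : ℕ} (Q : TDProblem S A d)

/-- J(θ) is the maximum over all y, hence over Y when a maximizer lies there; and J ≥ L(·, y')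
bounds the infimum of J from below. -/
lemma objective_sub_iInf_le_gap {alg : GradTD}
    (hmax : ∀ θ ∈ Q.X, ∃ y ∈ Q.Y, IsMaxOn (Q.saddle alg θ) Set.univ y) {θ : Vec d} (hθ : θ ∈ Q.X)
    (y' : Vec d) :
    Q.objective alg θ - (⨅ u : Q.X, Q.objective alg u) ≤ Q.gap alg θ y' := by
  have := Q.X_nonempty.to_subtype
  refine sub_le_sub ?_ ?_
  · obtain ⟨y, hy, hm⟩ := hmax θ hθ
    obtain ⟨⟨y₁, hy₁⟩, hub⟩ := Q.isGreatest_saddle alg θ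
    rw [← hy₁]
    refine (hm (Set.mem_univ y₁)).trans (le_ciSup (f := fun y : Q.Y => Q.saddle alg θ y) ?_ ⟨y, hy⟩)
    exact ⟨Q.objective alg θ, Set.forall_mem_range.2 fun v => hub ⟨v, rfl⟩⟩
  · refine le_ciInf fun u => (ciInf_le ?_ u).trans ((Q.isGreatest_saddle alg u).2 ⟨y', rfl⟩)
    -- The infimum in the gap is meaningful only if L(·, y') is bounded below on X; a finite convex
    -- function on ℝᵈ is continuous, and X is compact.
    have hcont : Continuous fun θ => Q.saddle alg θ y' := by
      rw [← continuousOn_univ]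
      exact (Q.convexOn_saddle alg y').continuousOn isOpen_univ
    have := (Q.X_compact.image hcont).bddBelow
    rwa [Set.image_eq_range] at this

/-- Under either choice of `L_K` the spectral norm of `Φᵀ Ξ (Φ - γ Φ')` is of order `L_{F*} + L_K`. -/
lemma normTD_le_two_mul (alg : GradTD) {LK : ℝ}
    (hLK : (LK = Q.normTD ^ 2 ∧ Q.IsStationary) ∨ LK = Q.normTD) :
    Q.normTD ≤ 2 * (Q.LFstar alg + LK) := by
  have h0 : 0 ≤ Q.normTD := norm_nonneg _
  have h1 := Q.LFstar_nonneg alg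
  rcases hLK with ⟨rfl, hs⟩ | rfl
  -- With L_K = B², GTD has L_{F*} = 1 and the bound is elementary; GTD2 has no such constant, and
  -- stationarity supplies B ≤ 2 L_{F*}.
  · cases alg
    · change Q.normTD ≤ 2 * (1 + Q.normTD ^ 2)
      nlinarith [sq_nonneg (Q.normTD - 1)]
    · nlinarith [Q.normTD_le hs]
  · linarith

lemma nonneg_of_LK {LK : ℝ} (hLK : (LK = Q.normTD ^ 2 ∧ Q.IsStationary) ∨ LK = Q.normTD) :
    0 ≤ LK := by
  rcases hLK with ⟨rfl, -⟩ | rfl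
  · exact sq_nonneg _
  · exact norm_nonneg _

/-- Reduces the mean norm of the summed noise to its second moment; `r` is later taken of order Λ√N
to balance the two terms. -/
lemma norm_le_sq_div_add {E : Type*} [SeminormedAddGroup E] (x : E) {r : ℝ} (hr : 0 < r) :
    ‖x‖ ≤ (1 / (2 * r)) * ‖x‖ ^ 2 + r / 2 := by
  have h : (1 / (2 * r)) * ‖x‖ ^ 2 + r / 2 - ‖x‖ = (1 / (2 * r)) * (‖x‖ - r) ^ 2 := by
    field_simp; ring
  have : 0 ≤ (1 / (2 * r)) * (‖x‖ - r) ^ 2 := by positivity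
  linarith

variable {Q} in
/-- Bound of the expected duality gap, before the step sizes are inserted. -/
lemma integral_gap_le {alg : GradTD} {α : ℕ → ℝ} {θ₀ y₀ : Vec d} (hθ : θ₀ ∈ Q.X)
    (hy : y₀ ∈ Q.Y) {D : ℝ} (hX : Metric.diam Q.X ≤ D) (hY : Metric.diam Q.Y ≤ D) {n : ℕ}
    (hα : ∀ t ≤ n, 0 < α t) (hanti : ∀ t < n, α (t + 1) ≤ α t) {σF σKθ σKy : ℝ}
    (hV : Q.VarianceBound alg σF σKθ σKy) {Ω : Type*} [MeasurableSpace Ω] {μ : Measure Ω}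
    [IsProbabilityMeasure μ] {Z : ℕ → Ω → S × A × S} (hZ : Q.IsIIDSample μ Z) {r : ℝ}
    (hr : 0 < r) :
    Integrable (fun ω => Q.gap alg (Q.average alg α θ₀ y₀ (fun i => Z i ω) (n + 1)).1
        (Q.average alg α θ₀ y₀ (fun i => Z i ω) (n + 1)).2) μ ∧
    ((n + 1 : ℕ) : ℝ) * ∫ ω, Q.gap alg (Q.average alg α θ₀ y₀ (fun i => Z i ω) (n + 1)).1
        (Q.average alg α θ₀ y₀ (fun i => Z i ω) (n + 1)).2 ∂μ
      ≤ D ^ 2 / α n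
        + ∑ t ∈ Finset.range (n + 1), α t * (Q.normTD ^ 2 * D ^ 2
            + (Q.LFstar alg + Q.normTD) ^ 2 * D ^ 2 + σKy ^ 2 + 2 * (σF ^ 2 + σKθ ^ 2))
        + D * ((1 / (2 * r)) * ((n + 1 : ℕ) * (2 * (σF ^ 2 + σKθ ^ 2))) + r / 2)
        + D * ((1 / (2 * r)) * ((n + 1 : ℕ) * σKy ^ 2) + r / 2) := by
  obtain ⟨hmeas, hlaw, hind⟩ := hZ
  have := Q.nonempty_state
  have := Q.nonempty_action
  have hD : 0 ≤ D := Metric.diam_nonneg.trans hX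
  set x : ℕ → (ℕ → S × A × S) → Vec d × Vec d := fun t zs => Q.iterates alg α θ₀ y₀ zs t with hx
  have hxd : ∀ t, DependsOn (x t) (Set.Iio t) := fun t zs zs' h =>
    Q.iterates_congr alg α θ₀ y₀ h
  have hmem : ∀ t zs, (x t zs).1 ∈ Q.X ∧ (x t zs).2 ∈ Q.Y := fun t zs => Q.iterates_mem hθ hy zs t
  set ε : ℕ → S × A × S → (ℕ → S × A × S) → Vec d := fun t z zs => Q.dualNoise alg z (x t zs)
    with hε
  set η : ℕ → S × A × S → (ℕ → S × A × S) → Vec d := fun t z zs => Q.primalNoise z (x t zs)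
    with hη
  have hεd : ∀ t z, DependsOn (ε t z) (Set.Iio t) := fun t z zs zs' h =>
    congrArg (Q.dualNoise alg z) (hxd t h)
  have hηd : ∀ t z, DependsOn (η t z) (Set.Iio t) := fun t z zs zs' h =>
    congrArg (Q.primalNoise z) (hxd t h)
  have hε0 : ∀ t zs, ∑ z, Q.weight z • ε t z zs = 0 := fun t zs => Q.expect_dualNoise alg _
  have hη0 : ∀ t zs, ∑ z, Q.weight z • η t z zs = 0 := fun t zs => Q.expect_primalNoise _
  have hεv : ∀ t zs, ∑ z, Q.weight z * ‖ε t z zs‖ ^ 2 ≤ 2 * (σF ^ 2 + σKθ ^ 2) := fun t zs =>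
    hV.dualNoise_le (hmem t zs).1 (hmem t zs).2
  have hηv : ∀ t zs, ∑ z, Q.weight z * ‖η t z zs‖ ^ 2 ≤ σKy ^ 2 := fun t zs =>
    hV.primalNoise_le (hmem t zs).1 (hmem t zs).2
  have hWε : ∀ t, DependsOn (fun zs => (x t zs).2 - y₀) (Set.Iio t) := fun t zs zs' h =>
    congrArg (fun p : Vec d × Vec d => p.2 - y₀) (hxd t h)
  have hWη : ∀ t, DependsOn (fun zs => θ₀ - (x t zs).1) (Set.Iio t) := fun t zs zs' h =>
    congrArg (fun p : Vec d × Vec d => θ₀ - p.1) (hxd t h)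
  have hgapd : DependsOn (fun zs => Q.gap alg (Q.average alg α θ₀ y₀ zs (n + 1)).1
      (Q.average alg α θ₀ y₀ zs (n + 1)).2) (Set.Iio (n + 1)) := fun zs zs' h =>
    congrArg (fun p : Vec d × Vec d => Q.gap alg p.1 p.2) (Q.average_congr alg α θ₀ y₀ h)
  have hgap := integrable_of_dependsOn (μ := μ) hmeas hgapd
  refine ⟨hgap, ?_⟩
  -- integrability of the terms of the pathwise bound
  have iη : ∀ t, Integrable (fun ω => ‖η t (Z t ω) fun i => Z i ω‖ ^ 2) μ := fun t =>
    integrable_of_dependsOn hmeas (f := fun zs => ‖η t (zs t) zs‖ ^ 2) fun zs zs' h =>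
      congrArg (‖·‖ ^ 2) (dependsOn_current (hηd t) h)
  have iε : ∀ t, Integrable (fun ω => ‖ε t (Z t ω) fun i => Z i ω‖ ^ 2) μ := fun t =>
    integrable_of_dependsOn hmeas (f := fun zs => ‖ε t (zs t) zs‖ ^ 2) fun zs zs' h =>
      congrArg (‖·‖ ^ 2) (dependsOn_current (hεd t) h)
  have iεW : ∀ t, Integrable
      (fun ω => ⟪ε t (Z t ω) fun i => Z i ω, (x t fun i => Z i ω).2 - y₀⟫) μ := fun t =>
    integrable_of_dependsOn hmeas (f := fun zs => ⟪ε t (zs t) zs, (x t zs).2 - y₀⟫)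
      (dependsOn_current (f := fun z zs => ⟪ε t z zs, (x t zs).2 - y₀⟫) fun z zs zs' h =>
        congrArg₂ (fun a b : Vec d => ⟪a, b⟫) (hεd t z h) (hWε t h))
  have iηW : ∀ t, Integrable
      (fun ω => ⟪η t (Z t ω) fun i => Z i ω, θ₀ - (x t fun i => Z i ω).1⟫) μ := fun t =>
    integrable_of_dependsOn hmeas (f := fun zs => ⟪η t (zs t) zs, θ₀ - (x t zs).1⟫)
      (dependsOn_current (f := fun z zs => ⟪η t z zs, θ₀ - (x t zs).1⟫) fun z zs zs' h =>
        congrArg₂ (fun a b : Vec d => ⟪a, b⟫) (hηd t z h) (hWη t h))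
  have iSε : Integrable
      (fun ω => ‖∑ t ∈ Finset.range (n + 1), ε t (Z t ω) fun i => Z i ω‖ ^ 2) μ :=
    integrable_of_dependsOn hmeas
      (f := fun zs => ‖∑ t ∈ Finset.range (n + 1), ε t (zs t) zs‖ ^ 2) fun zs zs' h =>
      congrArg (‖·‖ ^ 2) (dependsOn_sum_current hεd (n + 1) h)
  have iSη : Integrable
      (fun ω => ‖∑ t ∈ Finset.range (n + 1), η t (Z t ω) fun i => Z i ω‖ ^ 2) μ :=
    integrable_of_dependsOn hmeas
      (f := fun zs => ‖∑ t ∈ Finset.range (n + 1), η t (zs t) zs‖ ^ 2) fun zs zs' h =>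
      congrArg (‖·‖ ^ 2) (dependsOn_sum_current hηd (n + 1) h)
  set c₀ : ℝ := Q.normTD ^ 2 * D ^ 2 + (Q.LFstar alg + Q.normTD) ^ 2 * D ^ 2 with hc₀
  have i1 : ∀ t, Integrable (fun ω => α t * (c₀ + ‖η t (Z t ω) fun i => Z i ω‖ ^ 2
      + ‖ε t (Z t ω) fun i => Z i ω‖ ^ 2)) μ := fun t =>
    (((integrable_const c₀).add (iη t)).add (iε t)).const_mul (α t)
  have b1 : ∀ t ∈ Finset.range (n + 1), ∫ ω, α t * (c₀ + ‖η t (Z t ω) fun i => Z i ω‖ ^ 2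
      + ‖ε t (Z t ω) fun i => Z i ω‖ ^ 2) ∂μ
      ≤ α t * (c₀ + σKy ^ 2 + 2 * (σF ^ 2 + σKθ ^ 2)) := by
    intro t ht
    have h1 := integral_norm_sq_current_le hmeas hlaw hind hηd (hηv t)
    have h2 := integral_norm_sq_current_le hmeas hlaw hind hεd (hεv t)
    have i12 : Integrable (fun ω => c₀ + ‖η t (Z t ω) fun i => Z i ω‖ ^ 2) μ :=
      (integrable_const c₀).add (iη t)
    rw [integral_const_mul, integral_add i12 (iε t), integral_add (integrable_const c₀) (iη t),
      integral_const, probReal_univ, one_smul]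
    have := hα t (Nat.lt_succ_iff.1 (Finset.mem_range.1 ht))
    gcongr
  have b2 : ∀ t ∈ Finset.range (n + 1),
      ∫ ω, ⟪ε t (Z t ω) fun i => Z i ω, (x t fun i => Z i ω).2 - y₀⟫ ∂μ = 0 := fun t _ =>
    integral_inner_current hmeas hlaw hind hεd (hε0 t) (hWε t)
  have b3 : ∀ t ∈ Finset.range (n + 1),
      ∫ ω, ⟪η t (Z t ω) fun i => Z i ω, θ₀ - (x t fun i => Z i ω).1⟫ ∂μ = 0 := fun t _ =>
    integral_inner_current hmeas hlaw hind hηd (hη0 t) (hWη t)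
  have b4 := integral_norm_sq_sum_current_le hmeas hlaw hind hεd hε0 hεv (n + 1)
  have b5 := integral_norm_sq_sum_current_le hmeas hlaw hind hηd hη0 hηv (n + 1)
  set T₁ : Ω → ℝ := fun ω => ∑ t ∈ Finset.range (n + 1),
    α t * (c₀ + ‖η t (Z t ω) fun i => Z i ω‖ ^ 2 + ‖ε t (Z t ω) fun i => Z i ω‖ ^ 2) with hT₁
  set T₂ : Ω → ℝ := fun ω => ∑ t ∈ Finset.range (n + 1),
    ⟪ε t (Z t ω) fun i => Z i ω, (x t fun i => Z i ω).2 - y₀⟫ with hT₂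
  set T₃ : Ω → ℝ := fun ω => ∑ t ∈ Finset.range (n + 1),
    ⟪η t (Z t ω) fun i => Z i ω, θ₀ - (x t fun i => Z i ω).1⟫ with hT₃
  set T₄ : Ω → ℝ := fun ω => ‖∑ t ∈ Finset.range (n + 1), ε t (Z t ω) fun i => Z i ω‖ ^ 2 with hT₄
  set T₅ : Ω → ℝ := fun ω => ‖∑ t ∈ Finset.range (n + 1), η t (Z t ω) fun i => Z i ω‖ ^ 2 with hT₅
  have iT₁ : Integrable T₁ μ := integrable_finsetSum _ fun t _ => i1 t
  have iT₂ : Integrable T₂ μ := integrable_finsetSum _ fun t _ => iεW t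
  have iT₃ : Integrable T₃ μ := integrable_finsetSum _ fun t _ => iηW t
  have B₁ : ∫ ω, T₁ ω ∂μ
      ≤ ∑ t ∈ Finset.range (n + 1), α t * (c₀ + σKy ^ 2 + 2 * (σF ^ 2 + σKθ ^ 2)) := by
    rw [integral_finsetSum _ fun t _ => i1 t]
    exact Finset.sum_le_sum b1
  have B₂ : ∫ ω, T₂ ω ∂μ = 0 := by
    rw [integral_finsetSum _ fun t _ => iεW t, Finset.sum_eq_zero b2]
  have B₃ : ∫ ω, T₃ ω ∂μ = 0 := by
    rw [integral_finsetSum _ fun t _ => iηW t, Finset.sum_eq_zero b3]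
  set a : ℝ := D * (1 / (2 * r)) with ha
  have ha0 : 0 ≤ a := by positivity
  set k : ℝ := D ^ 2 / α n + D * (r / 2) + D * (r / 2) with hk
  -- `T₂` and `T₃` have mean zero, `T₁` is bounded by the variances, and orthogonality bounds `T₄`
  -- and `T₅`.
  have hpath : ∀ ω, ((n + 1 : ℕ) : ℝ) * Q.gap alg
      (Q.average alg α θ₀ y₀ (fun i => Z i ω) (n + 1)).1
      (Q.average alg α θ₀ y₀ (fun i => Z i ω) (n + 1)).2
      ≤ ((((k + T₁ ω) + T₂ ω) + T₃ ω) + a * T₄ ω) + a * T₅ ω := by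
    intro ω
    refine (Q.gap_average_le hθ hy hX hY hα hanti (fun i => Z i ω) _ rfl).trans ?_
    have h1 := mul_le_mul_of_nonneg_left
      (norm_le_sq_div_add (∑ t ∈ Finset.range (n + 1), ε t (Z t ω) fun i => Z i ω) hr) hD
    have h2 := mul_le_mul_of_nonneg_left
      (norm_le_sq_div_add (∑ t ∈ Finset.range (n + 1), η t (Z t ω) fun i => Z i ω) hr) hD
    simp only [hT₁, hT₂, hT₃, hT₄, hT₅, hk, ha, hε, hη, hx, hc₀] at h1 h2 ⊢
    linarith
  have j1 : Integrable (fun ω => k + T₁ ω) μ := (integrable_const k).add iT₁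
  have j2 : Integrable (fun ω => (k + T₁ ω) + T₂ ω) μ := j1.add iT₂
  have j3 : Integrable (fun ω => ((k + T₁ ω) + T₂ ω) + T₃ ω) μ := j2.add iT₃
  have j4 : Integrable (fun ω => (((k + T₁ ω) + T₂ ω) + T₃ ω) + a * T₄ ω) μ :=
    j3.add (iSε.const_mul a)
  have j5 : Integrable (fun ω => ((((k + T₁ ω) + T₂ ω) + T₃ ω) + a * T₄ ω) + a * T₅ ω) μ :=
    j4.add (iSη.const_mul a)
  have hint := integral_mono (hgap.const_mul ((n + 1 : ℕ) : ℝ)) j5 hpath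
  rw [integral_const_mul, integral_add j4 (iSη.const_mul a), integral_add j3 (iSε.const_mul a),
    integral_add j2 iT₃, integral_add j1 iT₂, integral_add (integrable_const k) iT₁,
    integral_const, probReal_univ, one_smul, integral_const_mul, integral_const_mul, B₂, B₃] at hint
  have h4 := mul_le_mul_of_nonneg_left b4 ha0
  have h5 := mul_le_mul_of_nonneg_left b5 ha0
  refine hint.trans ?_
  calc _ ≤ k + (∑ t ∈ Finset.range (n + 1), α t * (c₀ + σKy ^ 2 + 2 * (σF ^ 2 + σKθ ^ 2))) + 0 + 0
        + a * ((n + 1 : ℕ) * (2 * (σF ^ 2 + σKθ ^ 2))) + a * ((n + 1 : ℕ) * σKy ^ 2) := by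
        gcongr
    _ = _ := by rw [hk, ha]; ring

/-- The constant of the convergence rate. -/
noncomputable def rateConst (D c₁ c₂ : ℝ) : ℝ := D ^ 2 / c₁ + 2 * c₂ * (13 * D ^ 2 + 2) + 5 / 2 * D

variable {Q} in
lemma integral_gap_le_rate {alg : GradTD} {α : ℕ → ℝ} {θ₀ y₀ : Vec d} (hθ : θ₀ ∈ Q.X)
    (hy : y₀ ∈ Q.Y) {D c₁ c₂ : ℝ} (hc₁ : 0 < c₁) (hX : Metric.diam Q.X ≤ D)
    (hY : Metric.diam Q.Y ≤ D) {LK : ℝ}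
    (hLK : (LK = Q.normTD ^ 2 ∧ Q.IsStationary) ∨ LK = Q.normTD) {σF σKθ σKy : ℝ}
    (hV : Q.VarianceBound alg σF σKθ σKy) {Ω : Type*} [MeasurableSpace Ω] {μ : Measure Ω}
    [IsProbabilityMeasure μ] {Z : ℕ → Ω → S × A × S} (hZ : Q.IsIIDSample μ Z) {N : ℕ} (hN : 0 < N)
    (hα : StepRule c₁ c₂ (Q.LFstar alg + LK + noiseLevel σF σKθ σKy) N α) :
    Integrable (fun ω => Q.gap alg (Q.average alg α θ₀ y₀ (fun i => Z i ω) N).1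
        (Q.average alg α θ₀ y₀ (fun i => Z i ω) N).2) μ ∧
    ∫ ω, Q.gap alg (Q.average alg α θ₀ y₀ (fun i => Z i ω) N).1
        (Q.average alg α θ₀ y₀ (fun i => Z i ω) N).2 ∂μ
      ≤ rateConst D c₁ c₂ * ((Q.LFstar alg + LK + noiseLevel σF σKθ σKy) / √N) := by
  obtain ⟨n, rfl⟩ := Nat.exists_eq_succ_of_ne_zero hN.ne'
  rw [Nat.succ_eq_add_one] at *
  set Λ := Q.LFstar alg + LK + noiseLevel σF σKθ σKy with hΛ
  have hLF := Q.LFstar_nonneg alg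
  have hLK0 := Q.nonneg_of_LK hLK
  have hB0 : 0 ≤ Q.normTD := norm_nonneg _
  have hs0 : 0 ≤ √(σF ^ 2 + σKθ ^ 2) := Real.sqrt_nonneg _
  have hs2 : √(σF ^ 2 + σKθ ^ 2) ^ 2 = σF ^ 2 + σKθ ^ 2 := Real.sq_sqrt (by positivity)
  have hK0 := hV.σKy_nonneg
  have hnoise : noiseLevel σF σKθ σKy = √(σF ^ 2 + σKθ ^ 2) + σKy := rfl
  have hΛ0 : 0 ≤ Λ := by rw [hΛ, hnoise]; positivity
  have hD : 0 ≤ D := Metric.diam_nonneg.trans hX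
  have hsN : 0 < √((n + 1 : ℕ) : ℝ) := Real.sqrt_pos.2 (by positivity)
  have hsN2 : √((n + 1 : ℕ) : ℝ) ^ 2 = ((n + 1 : ℕ) : ℝ) := Real.sq_sqrt (by positivity)
  have hprod : ∀ t ≤ n, 0 < α t * (Λ * √((n + 1 : ℕ) : ℝ)) := fun t ht =>
    hc₁.trans_le (hα.lower t (by omega))
  have hαpos : ∀ t ≤ n, 0 < α t := fun t ht =>
    lt_of_not_ge fun h =>
      (hprod t ht).not_ge (mul_nonpos_of_nonpos_of_nonneg h (by positivity))
  -- Positivity of Λ is forced by the lower bound on the steps, since `c₁` is positive.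
  have hΛpos : 0 < Λ := by
    rcases hΛ0.lt_or_eq with h | h
    · exact h
    · have := hprod 0 (Nat.zero_le _)
      rw [← h] at this
      simp at this
  set r := Λ * √((n + 1 : ℕ) : ℝ) with hr
  have hrpos : 0 < r := mul_pos hΛpos hsN
  obtain ⟨hint, hbound⟩ := integral_gap_le hθ hy hX hY hαpos
    (fun t ht => hα.antitone t (by omega)) hV hZ hrpos
  refine ⟨hint, ?_⟩
  -- From B ≤ 2Λ and L_{F*} ≤ Λ come B² ≤ 4Λ² and (L_{F*} + B)² ≤ 9Λ², whence the 13 in `rateConst`;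
  -- its 2 is the bound `hσ3` on the noise.
  have hB : Q.normTD ≤ 2 * Λ := (Q.normTD_le_two_mul alg hLK).trans (by
    rw [hΛ, hnoise]; linarith)
  have hFΛ : Q.LFstar alg ≤ Λ := by rw [hΛ, hnoise]; linarith
  have hsΛ : √(σF ^ 2 + σKθ ^ 2) + σKy ≤ Λ := by rw [hΛ, hnoise]; linarith
  have hσ1 : σF ^ 2 + σKθ ^ 2 ≤ Λ ^ 2 := by
    rw [← hs2]; exact pow_le_pow_left₀ hs0 (by linarith) 2
  have hσ2 : σKy ^ 2 ≤ Λ ^ 2 := pow_le_pow_left₀ hK0 (by linarith) 2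
  have hσ3 : σKy ^ 2 + 2 * (σF ^ 2 + σKθ ^ 2) ≤ 2 * Λ ^ 2 := by
    rw [← hs2]
    have := pow_le_pow_left₀ (add_nonneg hs0 hK0) hsΛ 2
    nlinarith [mul_nonneg hs0 hK0, sq_nonneg σKy]
  have hB2 : Q.normTD ^ 2 ≤ 4 * Λ ^ 2 :=
    (pow_le_pow_left₀ hB0 hB 2).trans_eq (by ring)
  have hFB2 : (Q.LFstar alg + Q.normTD) ^ 2 ≤ 9 * Λ ^ 2 :=
    (pow_le_pow_left₀ (by positivity) (by linarith : _ ≤ 3 * Λ) 2).trans_eq (by ring)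
  have e1 : D ^ 2 / α n ≤ D ^ 2 / c₁ * r := by
    rw [div_mul_eq_mul_div, div_le_div_iff₀ (hαpos n le_rfl) hc₁]
    have := mul_le_mul_of_nonneg_left (hα.lower n (by omega)) (sq_nonneg D)
    linarith
  have e2 : ∑ t ∈ Finset.range (n + 1), α t * (Q.normTD ^ 2 * D ^ 2
      + (Q.LFstar alg + Q.normTD) ^ 2 * D ^ 2 + σKy ^ 2 + 2 * (σF ^ 2 + σKθ ^ 2))
      ≤ 2 * c₂ * (13 * D ^ 2 + 2) * r := by
    have hstep : ∀ t ∈ Finset.range (n + 1), α t * (Q.normTD ^ 2 * D ^ 2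
        + (Q.LFstar alg + Q.normTD) ^ 2 * D ^ 2 + σKy ^ 2 + 2 * (σF ^ 2 + σKθ ^ 2))
        ≤ (13 * D ^ 2 + 2) * Λ * c₂ * (1 / √((t : ℝ) + 1)) := by
      intro t ht
      have ht' := Finset.mem_range.1 ht
      have hst : 0 < √((t : ℝ) + 1) := Real.sqrt_pos.2 (by positivity)
      have h1 : Q.normTD ^ 2 * D ^ 2 + (Q.LFstar alg + Q.normTD) ^ 2 * D ^ 2 + σKy ^ 2
          + 2 * (σF ^ 2 + σKθ ^ 2) ≤ (13 * D ^ 2 + 2) * Λ ^ 2 := by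
        have := mul_le_mul_of_nonneg_right hB2 (sq_nonneg D)
        have := mul_le_mul_of_nonneg_right hFB2 (sq_nonneg D)
        linarith
      refine (mul_le_mul_of_nonneg_left h1 (hαpos t (by omega)).le).trans ?_
      rw [mul_one_div, le_div_iff₀ hst]
      have h2 := mul_le_mul_of_nonneg_left (hα.upper t ht')
        (by positivity : 0 ≤ (13 * D ^ 2 + 2) * Λ)
      linarith
    refine (Finset.sum_le_sum hstep).trans ?_
    rw [← Finset.mul_sum]
    -- The sign of `c₂` follows from the upper bound on the first step.
    have hc₂ : 0 ≤ c₂ := le_trans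
      (mul_nonneg (hαpos 0 (Nat.zero_le _)).le (by positivity)) (hα.upper 0 (by omega))
    refine (mul_le_mul_of_nonneg_left (sum_inv_sqrt_le (n + 1)) (by positivity)).trans_eq ?_
    rw [hr]; ring
  have hrr : 1 / (2 * r) * (((n + 1 : ℕ) : ℝ) * Λ ^ 2) = r / 2 := by
    rw [← hsN2, hr]; field_simp
  have e3 : 1 / (2 * r) * (((n + 1 : ℕ) : ℝ) * (2 * (σF ^ 2 + σKθ ^ 2))) ≤ r := by
    calc _ ≤ 1 / (2 * r) * (((n + 1 : ℕ) : ℝ) * (2 * Λ ^ 2)) := by gcongr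
      _ = 2 * (1 / (2 * r) * (((n + 1 : ℕ) : ℝ) * Λ ^ 2)) := by ring
      _ = r := by rw [hrr]; ring
  have e4 : 1 / (2 * r) * (((n + 1 : ℕ) : ℝ) * σKy ^ 2) ≤ r / 2 := by
    rw [← hrr]; gcongr
  -- Together with the two terms D r / 2 this gives 3/2 from the dual noise and 1 from the primal
  -- noise, the 5/2 of `rateConst`.
  have e5 := mul_le_mul_of_nonneg_left e3 hD
  have e6 := mul_le_mul_of_nonneg_left e4 hD
  have hfin : ((n + 1 : ℕ) : ℝ) * (∫ ω, Q.gap alg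
      (Q.average alg α θ₀ y₀ (fun i => Z i ω) (n + 1)).1
      (Q.average alg α θ₀ y₀ (fun i => Z i ω) (n + 1)).2 ∂μ) ≤ rateConst D c₁ c₂ * r := by
    refine hbound.trans ?_
    rw [rateConst]
    linarith
  have hfin' : ((n + 1 : ℕ) : ℝ) * (rateConst D c₁ c₂ * (Λ / √((n + 1 : ℕ) : ℝ)))
      = rateConst D c₁ c₂ * r := by
    rw [hr, ← hsN2, Real.sqrt_sq hsN.le]
    field_simp
  rw [← hfin'] at hfin
  exact le_of_mul_le_mul_left hfin (by positivity)

variable {Q} in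
/-- Given the samples before time `t`, the gradient estimates at time `t` are unbiased. -/
lemma condExp_oracles (alg : GradTD) {Ω : Type*} [MeasurableSpace Ω] {μ : Measure Ω}
    [IsProbabilityMeasure μ] {Z : ℕ → Ω → S × A × S} (hZ : Q.IsIIDSample μ Z) (α : ℕ → ℝ)
    (θ₀ y₀ : Vec d) (t : ℕ) :
    μ[fun ω => Q.oracleK (Z t ω) (Q.iterates alg α θ₀ y₀ (fun i => Z i ω) t).1
        - Q.oracleF alg (Z t ω) (Q.iterates alg α θ₀ y₀ (fun i => Z i ω) t).2 | pastAlgebra Z t]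
      =ᵐ[μ] (fun ω => gradient
        (Q.saddle alg (Q.iterates alg α θ₀ y₀ (fun i => Z i ω) t).1)
        (Q.iterates alg α θ₀ y₀ (fun i => Z i ω) t).2) ∧
    μ[fun ω => Q.oracleKT (Z t ω) (Q.iterates alg α θ₀ y₀ (fun i => Z i ω) t).2 | pastAlgebra Z t]
      =ᵐ[μ] (fun ω => gradient
        (fun θ' => ⟪Q.K θ', (Q.iterates alg α θ₀ y₀ (fun i => Z i ω) t).2⟫)
        (Q.iterates alg α θ₀ y₀ (fun i => Z i ω) t).1) := by
  have := Q.nonempty_state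
  have := Q.nonempty_action
  have hd : DependsOn (fun zs => Q.iterates alg α θ₀ y₀ zs t) (Set.Iio t) := fun zs zs' h =>
    Q.iterates_congr alg α θ₀ y₀ h
  constructor
  · refine (condExp_sample hZ.measurable hZ.law hZ.indep (f := fun z zs =>
      Q.oracleK z (Q.iterates alg α θ₀ y₀ zs t).1 - Q.oracleF alg z (Q.iterates alg α θ₀ y₀ zs t).2)
      fun z zs zs' h => congrArg (fun p : Vec d × Vec d => Q.oracleK z p.1 - Q.oracleF alg z p.2)
        (hd h)).trans (.of_forall fun ω => ?_)
    exact (Q.hasGradientAt_saddle alg _ _).gradient.symm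
  · refine (condExp_sample hZ.measurable hZ.law hZ.indep (f := fun z zs =>
      Q.oracleKT z (Q.iterates alg α θ₀ y₀ zs t).2)
      fun z zs zs' h => congrArg (fun p : Vec d × Vec d => Q.oracleKT z p.2)
        (hd h)).trans (.of_forall fun ω => ?_)
    exact (Q.hasGradientAt_inner_K _ _).gradient.symm

end TDProblem

theorem proposition1 :
    -- the saddle-point function is a primal-dual form of the objective
    (∀ (S A : Type*) [Fintype S] [DecidableEq S] [Fintype A] (d : ℕ) (Q : TDProblem S A d)
        (alg : GradTD) (θ : Vec d),
      IsGreatest (Set.range (Q.saddle alg θ)) (Q.objective alg θ)) ∧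
    -- one sample gives unbiased estimates of the gradients of the saddle-point function
    (∀ (S A : Type*) [Fintype S] [DecidableEq S] [Fintype A] (d : ℕ) (Q : TDProblem S A d)
        (alg : GradTD) (θ y : Vec d),
      HasGradientAt (Q.Fstar alg) (Q.expect fun z => Q.oracleF alg z y) y ∧
      Q.expect (fun z => Q.oracleK z θ) = Q.K θ ∧
      HasGradientAt (fun θ' => ⟪Q.K θ', y⟫) (Q.expect fun z => Q.oracleKT z y) θ ∧
      HasGradientAt (Q.saddle alg θ) (Q.expect fun z => Q.oracleK z θ - Q.oracleF alg z y) y) ∧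
    -- along the iterates the estimates are conditionally unbiased given the past samples
    (∀ (S A : Type*) [Fintype S] [DecidableEq S] [Fintype A] (d : ℕ) (Q : TDProblem S A d)
        (alg : GradTD) (Ω : Type*) [MeasurableSpace Ω] (μ : Measure Ω) [IsProbabilityMeasure μ]
        (Z : ℕ → Ω → S × A × S) (_ : Q.IsIIDSample μ Z)
        (α : ℕ → ℝ) (θ₀ y₀ : Vec d) (t : ℕ),
      let θ : Ω → Vec d := fun ω => (Q.iterates alg α θ₀ y₀ (fun i => Z i ω) t).1
      let y : Ω → Vec d := fun ω => (Q.iterates alg α θ₀ y₀ (fun i => Z i ω) t).2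
      μ[fun ω => Q.oracleK (Z t ω) (θ ω) - Q.oracleF alg (Z t ω) (y ω) | pastAlgebra Z t]
        =ᵐ[μ] (fun ω => gradient (Q.saddle alg (θ ω)) (y ω)) ∧
      μ[fun ω => Q.oracleKT (Z t ω) (y ω) | pastAlgebra Z t]
        =ᵐ[μ] (fun ω => gradient (fun θ' => ⟪Q.K θ', y ω⟫) (θ ω))) ∧
    -- the convergence rate of the averaged iterates
    (∀ D c₁ c₂ : ℝ, 0 < c₁ → ∃ C : ℝ,
      ∀ (S A : Type*) [Fintype S] [DecidableEq S] [Fintype A] (d : ℕ) (Q : TDProblem S A d)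
        (alg : GradTD) (_ : Metric.diam Q.X ≤ D) (_ : Metric.diam Q.Y ≤ D)
        (LK : ℝ) (_ : (LK = Q.normTD ^ 2 ∧ Q.IsStationary) ∨ LK = Q.normTD)
        (σF σKθ σKy : ℝ) (_ : Q.VarianceBound alg σF σKθ σKy)
        (Ω : Type*) [MeasurableSpace Ω] (μ : Measure Ω) [IsProbabilityMeasure μ]
        (Z : ℕ → Ω → S × A × S) (_ : Q.IsIIDSample μ Z)
        (N : ℕ) (_ : 0 < N) (α : ℕ → ℝ)
        (_ : StepRule c₁ c₂ (Q.LFstar alg + LK + noiseLevel σF σKθ σKy) N α)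
        (θ₀ : Vec d) (_ : θ₀ ∈ Q.X) (y₀ : Vec d) (_ : y₀ ∈ Q.Y),
      let θbar : Ω → Vec d := fun ω => (Q.average alg α θ₀ y₀ (fun i => Z i ω) N).1
      let ybar : Ω → Vec d := fun ω => (Q.average alg α θ₀ y₀ (fun i => Z i ω) N).2
      let rate : ℝ := (Q.LFstar alg + LK + noiseLevel σF σKθ σKy) / √N
      (Integrable (fun ω => Q.gap alg (θbar ω) (ybar ω)) μ ∧
        ∫ ω, Q.gap alg (θbar ω) (ybar ω) ∂μ ≤ C * rate) ∧
      ((∀ θ ∈ Q.X, ∃ y ∈ Q.Y, IsMaxOn (Q.saddle alg θ) Set.univ y) →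
        Integrable (fun ω => Q.objective alg (θbar ω)) μ ∧
        ∫ ω, Q.objective alg (θbar ω) ∂μ - (⨅ θ : Q.X, Q.objective alg θ) ≤ C * rate)) := by
  refine ⟨fun S A _ _ _ d Q alg θ => Q.isGreatest_saddle alg θ,
    fun S A _ _ _ d Q alg θ y => ⟨?_, Q.expect_oracleK θ, Q.hasGradientAt_inner_K θ y,
      Q.hasGradientAt_saddle alg θ y⟩,
    fun S A _ _ _ d Q alg Ω _ μ _ Z hZ α θ₀ y₀ t =>
      TDProblem.condExp_oracles alg hZ α θ₀ y₀ t, fun D c₁ c₂ hc₁ =>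
    ⟨TDProblem.rateConst D c₁ c₂, ?_⟩⟩
  · rw [Q.expect_oracleF]
    exact Q.hasGradientAt_Fstar alg y
  intro S A _ _ _ d Q alg hX hY LK hLK σF σKθ σKy hV Ω _ μ _ Z hZ N hN α hα θ₀ hθ y₀ hy
  have hgap := TDProblem.integral_gap_le_rate hθ hy hc₁ hX hY hLK hV hZ hN hα
  refine ⟨hgap, fun hmax => ?_⟩
  have := Q.nonempty_state
  have := Q.nonempty_action
  have hobj : Integrable
      (fun ω => Q.objective alg (Q.average alg α θ₀ y₀ (fun i => Z i ω) N).1) μ :=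
    integrable_of_dependsOn hZ.measurable (t := N)
      (f := fun zs => Q.objective alg (Q.average alg α θ₀ y₀ zs N).1) fun zs zs' h =>
      congrArg (fun p : Vec d × Vec d => Q.objective alg p.1) (Q.average_congr alg α θ₀ y₀ h)
  refine ⟨hobj, le_trans ?_ hgap.2⟩
  have h := integral_mono (hobj.sub (integrable_const (⨅ θ : Q.X, Q.objective alg θ))) hgap.1
    fun ω => Q.objective_sub_iInf_le_gap hmax (Q.average_fst_mem hθ hy (fun i => Z i ω) hN) _
  rwa [integral_sub' hobj (integrable_const _), integral_const, probReal_univ, one_smul] at h
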